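/- **Theorem 0.1.** Let $(M,\mu)$ and $(N,\nu)$ be arbitrary measure spaces, and let $A_0=L^\infty(d\mu;L^1(d\nu))$ and $A_1=L^\infty(d\nu;L^1(d\mu))$ be the Bochner spaces of real or complex scalars. Elements of $A_0$ and $A_1$ are regarded as measurable functions on $M\times N$, two functions being identified if they agree almost everywhere on every measurable rectangle $E\times F$ with $\mu(E)<\infty$ and $\nu(F)<\infty$ (for $\sigma$-finite measures this is the usual almost everywhere identification). For $f\in A_0+A_1$ and $t>0$ let $$K_t(f;A_0,A_1)=\inf\{\|f_0\|_{A_0}+t\,\|f_1\|_{A_1} : f=f_0+f_1,\ f_0\in A_0,\ f_1\in A_1\}.$$ Then for every $f\in A_0+A_1$ and every $t>0$, $$\tfrac12\,K_t(f;A_0,A_1)\;\le\;\sup_{E,F}\Big(\mu(E)\vee t^{-1}\nu(F)\Big)^{-1}\int_{E\times F}|f|\,d\mu\,d\nu\;\le\;K_t(f;A_0,A_1),$$ where the supremum runs over all measurable sets $E\subset M$ and $F\subset N$ of positive and finite measure (it is $0$ if there are no such sets), and $u\vee v$ denotes the maximum of $u$ and $v$. -/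

import Mathlib

open MeasureTheory
open scoped ENNReal

/-- The Bochner space `L^∞(dμ ; L^1(dν))`. -/
abbrev LInftyL1 (𝕜 : Type*) [RCLike 𝕜] {M N : Type*} [MeasurableSpace M] [MeasurableSpace N]
    (μ : Measure M) (ν : Measure N) : Type _ :=
  Lp (Lp 𝕜 1 ν) ∞ μ

/-- The jointly measurable function `b` on `M × N` is a realization of the element `u` of
`L^∞(dμ ; L^1(dν))`: for `μ`-almost every `x` the section `b (x, ·)` is the class `u x` in
`L^1(dν)`. Every `u` has such a realization, and any two of them agree almost everywhere on
every rectangle with sides of finite measure. -/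
def Realizes {𝕜 : Type*} [RCLike 𝕜] {M N : Type*} [MeasurableSpace M] [MeasurableSpace N]
    {μ : Measure M} {ν : Measure N} (b : M × N → 𝕜) (u : LInftyL1 𝕜 μ ν) : Prop :=
  Measurable b ∧ ∀ᵐ x ∂μ, (fun y => b (x, y)) =ᵐ[ν] (u x : N → 𝕜)

/-- Equality of functions on `M × N` as elements of the common ambient space of the couple:
equality almost everywhere on every measurable rectangle with sides of finite measure. For
σ-finite `μ` and `ν` this is equality almost everywhere for the product measure. -/
def LocallyAEEq {𝕜 : Type*} {M N : Type*} [MeasurableSpace M] [MeasurableSpace N]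
    (μ : Measure M) (ν : Measure N) (f g : M × N → 𝕜) : Prop :=
  ∀ (E : Set M) (F : Set N), MeasurableSet E → MeasurableSet F → μ E < ∞ → ν F < ∞ →
    f =ᵐ[(μ.restrict E).prod (ν.restrict F)] g

/-- `f = u + v` in the ambient space, with `u` in `A₀ = L^∞(dμ ; L^1(dν))` and `v` in
`A₁ = L^∞(dν ; L^1(dμ))`. -/
def IsSumOf {𝕜 : Type*} [RCLike 𝕜] {M N : Type*} [MeasurableSpace M] [MeasurableSpace N]
    {μ : Measure M} {ν : Measure N} (f : M × N → 𝕜)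
    (u : LInftyL1 𝕜 μ ν) (v : LInftyL1 𝕜 ν μ) : Prop :=
  ∃ b c : M × N → 𝕜, Realizes b u ∧ Realizes (fun z : N × M => c (z.2, z.1)) v ∧
    LocallyAEEq μ ν f (fun z => b z + c z)

/-- `f` belongs to `A₀ + A₁`. -/
def MemSum {𝕜 : Type*} [RCLike 𝕜] {M N : Type*} [MeasurableSpace M] [MeasurableSpace N]
    (μ : Measure M) (ν : Measure N) (f : M × N → 𝕜) : Prop :=
  ∃ (u : LInftyL1 𝕜 μ ν) (v : LInftyL1 𝕜 ν μ), IsSumOf f u v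

/-- The functional `K_t(f ; A₀, A₁)`, the infimum of `‖u‖_{A₀} + t ‖v‖_{A₁}` over all
decompositions `f = u + v`. -/
noncomputable def kFunctional {𝕜 : Type*} [RCLike 𝕜] {M N : Type*} [MeasurableSpace M]
    [MeasurableSpace N] (μ : Measure M) (ν : Measure N) (t : ℝ) (f : M × N → 𝕜) : ℝ≥0∞ :=
  ⨅ (u : LInftyL1 𝕜 μ ν) (v : LInftyL1 𝕜 ν μ) (_ : IsSumOf f u v),
    ENNReal.ofReal (‖u‖ + t * ‖v‖)

/-- The supremum of `(μ(E) ∨ t⁻¹ ν(F))⁻¹ ∫_{E × F} |f| dμ dν` over all measurable sets `E ⊆ M`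
and `F ⊆ N` of positive and finite measure. -/
noncomputable def rectangleSup {𝕜 : Type*} [RCLike 𝕜] {M N : Type*} [MeasurableSpace M]
    [MeasurableSpace N] (μ : Measure M) (ν : Measure N) (t : ℝ) (f : M × N → 𝕜) : ℝ≥0∞ :=
  ⨆ (E : Set M) (F : Set N) (_ : MeasurableSet E ∧ 0 < μ E ∧ μ E < ∞)
    (_ : MeasurableSet F ∧ 0 < ν F ∧ ν F < ∞),
    (max (μ E) (ENNReal.ofReal t⁻¹ * ν F))⁻¹ *
      ∫⁻ z, ‖f z‖ₑ ∂((μ.restrict E).prod (ν.restrict F))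

/-! The bound of the supremum by K is direct: on E × F the two summands contribute at most ‖u‖ μ(E)
and ‖v‖ ν(F). For the other bound let r exceed the supremum. In the σ-finite case the measure η =
|f| dμ dν satisfies η(E × F) ≤ r μ(E) + (r/t) ν(F), since a maximum is at most the sum. This is a
Hall condition, and it yields a weight φ with values in [0, 1] such that φ|f| has fibre integrals at
most r over N and (1 - φ)|f| has fibre integrals at most r/t over M. Then f = φf + (1 - φ)f costs at
most r + t(r/t) = 2r, which is where the factor 1/2 comes from.

On a finite grid φ comes from `exists_split_of_forall_rectangle`: minimise the sum of the squared
excesses over the cube of all weights. The first-order condition at the minimiser, together with the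
rectangle hypothesis integrated over superlevel sets of the excesses, forces the minimum to be 0. In
`exists_add_eq_of_forall_rectangle` an ultrafilter limit of grid splittings gives finitely additive
set functions; domination by η makes them countably additive on pieces of finite η-measure.
Radon–Nikodym derivatives then give the weights.

For arbitrary measures, strong measurability confines the values of an element of either space to a
σ-finite set, so f = b + c with b carried by M × B and c by A × N. After σ-finite enlargements of A
and B, the fibres of b outside A and those of c outside B already obey the required bounds locally
(`exists_sigmaFinite_forall_ae_le`), and only A × B has to be split. `exists_realizes` turns the
resulting functions into elements of the Bochner spaces. -/

/-! ### Fractional Hall theorem on finite grids. -/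

/-- Discrete layer-cake inequality. -/
theorem sum_min_mul_le_of_forall_rectangle {I J : Type*} [Fintype I] [Fintype J]
    (η : I → J → ℝ) (m : I → ℝ) (n : J → ℝ)
    (h : ∀ (A : Set I) (B : Set J),
      ∑ i, ∑ j, A.indicator 1 i * B.indicator 1 j * η i j
        ≤ ∑ i, A.indicator 1 i * m i + ∑ j, B.indicator 1 j * n j)
    (p : I → ℝ) (q : J → ℝ) (hp : ∀ i, 0 ≤ p i) (hq : ∀ j, 0 ≤ q j) :
    ∑ i, ∑ j, min (p i) (q j) * η i j ≤ ∑ i, p i * m i + ∑ j, q j * n j := by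
  set R : ℝ := ∑ i, p i + ∑ j, q j with hR
  have hpR : ∀ i, p i ≤ R := fun i => by
    have := Finset.single_le_sum (fun i _ => hp i) (Finset.mem_univ i)
    have := Finset.sum_nonneg (fun j (_ : j ∈ Finset.univ) => hq j)
    linarith
  have hqR : ∀ j, q j ≤ R := fun j => by
    have := Finset.single_le_sum (fun i _ => hq i) (Finset.mem_univ j)
    have := Finset.sum_nonneg (fun j (_ : j ∈ Finset.univ) => hp j)
    linarith
  have key : ∀ a : ℝ, 0 ≤ a → a ≤ R →
      ∫ s in Set.Ico 0 R, (Set.Iio a).indicator (1 : ℝ → ℝ) s = a := by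
    intro a ha haR
    rw [setIntegral_indicator measurableSet_Iio]
    have : Set.Ico 0 R ∩ Set.Iio a = Set.Ico 0 a := by
      ext s; simp only [Set.mem_inter_iff, Set.mem_Ico, Set.mem_Iio]
      constructor
      · rintro ⟨⟨h1, h2⟩, h3⟩; exact ⟨h1, h3⟩
      · rintro ⟨h1, h3⟩; exact ⟨⟨h1, by linarith⟩, h3⟩
    rw [this]
    simp [ha]
  have hint : ∀ a : ℝ, Integrable ((Set.Iio a).indicator (1 : ℝ → ℝ))
      (volume.restrict (Set.Ico 0 R)) := fun a =>
    (integrable_const (1 : ℝ)).indicator measurableSet_Iio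
  have e1 : ∑ i, ∑ j, min (p i) (q j) * η i j
      = ∫ s in Set.Ico 0 R, ∑ i, ∑ j,
        (Set.Iio (min (p i) (q j))).indicator (1 : ℝ → ℝ) s * η i j := by
    rw [integral_finsetSum _ fun i _ => integrable_finsetSum _ fun j _ => (hint _).mul_const _]
    refine Finset.sum_congr rfl fun i _ => ?_
    rw [integral_finsetSum _ fun j _ => (hint _).mul_const _]
    refine Finset.sum_congr rfl fun j _ => ?_
    rw [integral_mul_const, key _ (le_min (hp i) (hq j)) ((min_le_left _ _).trans (hpR i))]
  have e2 : ∑ i, p i * m i + ∑ j, q j * n j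
      = ∫ s in Set.Ico 0 R, (∑ i, (Set.Iio (p i)).indicator (1 : ℝ → ℝ) s * m i
        + ∑ j, (Set.Iio (q j)).indicator (1 : ℝ → ℝ) s * n j) := by
    rw [integral_add (integrable_finsetSum _ fun i _ => (hint _).mul_const _)
      (integrable_finsetSum _ fun i _ => (hint _).mul_const _),
      integral_finsetSum _ fun i _ => (hint _).mul_const _,
      integral_finsetSum _ fun i _ => (hint _).mul_const _]
    congr 1
    · exact Finset.sum_congr rfl fun i _ => by rw [integral_mul_const, key _ (hp i) (hpR i)]
    · exact Finset.sum_congr rfl fun i _ => by rw [integral_mul_const, key _ (hq i) (hqR i)]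
  rw [e1, e2]
  refine integral_mono (integrable_finsetSum _ fun i _ => integrable_finsetSum _ fun j _ =>
    (hint _).mul_const _) ((integrable_finsetSum _ fun i _ => (hint _).mul_const _).add
      (integrable_finsetSum _ fun i _ => (hint _).mul_const _)) fun s => ?_
  -- The superlevel set of a minimum is the intersection of the superlevel sets, so at height s the
  -- left side is a rectangle sum.
  have := h {i | s < p i} {j | s < q j}
  refine le_of_eq_of_le ?_ (this.trans_eq ?_)
  · refine Finset.sum_congr rfl fun i _ => Finset.sum_congr rfl fun j _ => ?_
    by_cases h1 : s < p i <;> by_cases h2 : s < q j <;> simp [Set.indicator, h1, h2]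
  · congr 1

/-- A quadratic majorant of the squared positive part, with equality at y = 0. It allows a
first-order variation without differentiating the positive part. -/
theorem sq_max_add_le (x y : ℝ) : (max (x + y) 0) ^ 2 ≤ (max x 0 + y) ^ 2 := by
  rcases le_total (x + y) 0 with h | h
  · rw [max_eq_right h]; nlinarith [sq_nonneg (max x 0 + y)]
  · rw [max_eq_left h]
    have := le_max_left x 0
    nlinarith

/-- Fractional Hall theorem for two-sided capacities on a finite grid. -/
theorem exists_split_of_forall_rectangle {I J : Type*} [Fintype I] [Fintype J]
    (η : I → J → ℝ) (m : I → ℝ) (n : J → ℝ)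
    (h : ∀ (A : Set I) (B : Set J),
      ∑ i, ∑ j, A.indicator 1 i * B.indicator 1 j * η i j
        ≤ ∑ i, A.indicator 1 i * m i + ∑ j, B.indicator 1 j * n j) :
    ∃ φ : I → J → ℝ, (∀ i j, 0 ≤ φ i j ∧ φ i j ≤ 1) ∧ (∀ i, ∑ j, φ i j * η i j ≤ m i) ∧
      ∀ j, ∑ i, (1 - φ i j) * η i j ≤ n j := by
  let r : (I → J → ℝ) → I → ℝ := fun φ i => ∑ j, φ i j * η i j - m i
  let s : (I → J → ℝ) → J → ℝ := fun φ j => ∑ i, (1 - φ i j) * η i j - n j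
  -- The penalty vanishes exactly when all row and column constraints hold.
  let Q : (I → J → ℝ) → ℝ := fun φ =>
    ∑ i, (max (r φ i) 0) ^ 2 + ∑ j, (max (s φ j) 0) ^ 2
  have hcpt : IsCompact (Set.Icc (0 : I → J → ℝ) 1) := isCompact_Icc
  obtain ⟨φ, hφ, hmin⟩ := hcpt.exists_isMinOn ⟨0, by simp [zero_le_one]⟩
    (f := Q) (by fun_prop)
  set p : I → ℝ := fun i => max (r φ i) 0 with hp
  set q : J → ℝ := fun j => max (s φ j) 0 with hq
  -- This competitor satisfies p ψ + q (1 - ψ) = min p q in each cell, so moving towards it brings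
  -- in the layer-cake sum.
  let ψ : I → J → ℝ := fun i j => if p i < q j then 1 else 0
  have hψ : ψ ∈ Set.Icc (0 : I → J → ℝ) 1 := by
    constructor <;> intro i j <;> by_cases h : p i < q j <;> simp [ψ, h]
  let a : I → ℝ := fun i => ∑ j, (ψ i j - φ i j) * η i j
  let b : J → ℝ := fun j => - ∑ i, (ψ i j - φ i j) * η i j
  have hvar : ∀ ε : ℝ, 0 < ε → ε ≤ 1 →
      0 ≤ 2 * (∑ i, p i * a i + ∑ j, q j * b j) + ε * (∑ i, a i ^ 2 + ∑ j, b j ^ 2) := by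
    intro ε h0 h1
    have hmem : (fun i j => φ i j + ε * (ψ i j - φ i j)) ∈ Set.Icc (0 : I → J → ℝ) 1 := by
      constructor
      · intro i j
        have := hφ.1 i j; have := hψ.1 i j
        simp only [Pi.zero_apply] at *
        nlinarith
      · intro i j
        have := hφ.2 i j; have := hψ.2 i j
        simp only [Pi.one_apply] at *
        nlinarith
    have hle := hmin hmem
    have hr : ∀ i, r (fun i j => φ i j + ε * (ψ i j - φ i j)) i = r φ i + ε * a i := by
      intro i
      simp only [r, a, Finset.mul_sum]
      rw [sub_add_eq_add_sub, ← Finset.sum_add_distrib]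
      congr 1
      exact Finset.sum_congr rfl fun j _ => by ring
    have hs : ∀ j, s (fun i j => φ i j + ε * (ψ i j - φ i j)) j = s φ j + ε * b j := by
      intro j
      simp only [s, b, mul_neg, Finset.mul_sum]
      rw [sub_add_eq_add_sub, ← sub_eq_add_neg, ← Finset.sum_sub_distrib]
      congr 1
      exact Finset.sum_congr rfl fun j _ => by ring
    have hQ : Q (fun i j => φ i j + ε * (ψ i j - φ i j)) ≤
        ∑ i, (p i + ε * a i) ^ 2 + ∑ j, (q j + ε * b j) ^ 2 := by
      simp only [Q, hr, hs]
      exact add_le_add (Finset.sum_le_sum fun i _ => sq_max_add_le _ _)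
        (Finset.sum_le_sum fun i _ => sq_max_add_le _ _)
    have hexp : ∑ i, (p i + ε * a i) ^ 2 + ∑ j, (q j + ε * b j) ^ 2
        = Q φ + ε * (2 * (∑ i, p i * a i + ∑ j, q j * b j)
          + ε * (∑ i, a i ^ 2 + ∑ j, b j ^ 2)) := by
      have e1 : ∑ i, (p i + ε * a i) ^ 2 = ∑ i, p i ^ 2 + ε * (2 * ∑ i, p i * a i)
          + ε * (ε * ∑ i, a i ^ 2) := by
        simp only [Finset.mul_sum, ← Finset.sum_add_distrib]
        exact Finset.sum_congr rfl fun j _ => by ring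
      have e2 : ∑ i, (q i + ε * b i) ^ 2 = ∑ i, q i ^ 2 + ε * (2 * ∑ i, q i * b i)
          + ε * (ε * ∑ i, b i ^ 2) := by
        simp only [Finset.mul_sum, ← Finset.sum_add_distrib]
        exact Finset.sum_congr rfl fun j _ => by ring
      have e3 : Q φ = ∑ i, p i ^ 2 + ∑ j, q j ^ 2 := rfl
      rw [e1, e2, e3]; ring
    have hle' : Q φ ≤ Q φ + ε * (2 * (∑ i, p i * a i + ∑ j, q j * b j)
          + ε * (∑ i, a i ^ 2 + ∑ j, b j ^ 2)) := hexp ▸ (hle.trans hQ)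
    by_contra hneg
    push Not at hneg
    nlinarith
  have hder : 0 ≤ ∑ i, p i * a i + ∑ j, q j * b j := by
    set X := ∑ i, p i * a i + ∑ j, q j * b j
    set C := ∑ i, a i ^ 2 + ∑ j, b j ^ 2
    have hC : 0 ≤ C := by positivity
    by_contra hneg
    push Not at hneg
    -- With C ≥ 0 and X < 0 this ε lies in (0, 1] and has εC ≤ -X, so 2X + εC ≤ X < 0, against the
    -- variation inequality.
    have hpos : 0 < -X / (C - X) := div_pos (by linarith) (by linarith)
    have := hvar (-X / (C - X)) hpos ((div_le_one (by linarith)).2 (by linarith))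
    have h2 : -X / (C - X) * C ≤ -X := by
      rw [div_mul_eq_mul_div, div_le_iff₀ (by linarith)]
      nlinarith
    linarith
  have hlayer := sum_min_mul_le_of_forall_rectangle η m n h p q (fun i => le_max_right _ _)
    fun j => le_max_right _ _
  have hsq : ∑ i, p i ^ 2 + ∑ j, q j ^ 2 ≤ 0 := by
    have f1 : ∑ i, p i ^ 2 = ∑ i, ∑ j, p i * φ i j * η i j - ∑ i, p i * m i := by
      rw [← Finset.sum_sub_distrib]
      refine Finset.sum_congr rfl fun i _ => ?_
      have : p i ^ 2 = p i * r φ i := by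
        simp only [hp]
        rcases le_total (r φ i) 0 with h | h
        · simp [max_eq_right h]
        · simp [max_eq_left h, sq]
      rw [this]
      simp only [r, mul_sub, Finset.mul_sum, mul_assoc]
    have f2 : ∑ j, q j ^ 2 = ∑ i, ∑ j, q j * (1 - φ i j) * η i j - ∑ j, q j * n j := by
      rw [Finset.sum_comm, ← Finset.sum_sub_distrib]
      refine Finset.sum_congr rfl fun j _ => ?_
      have : q j ^ 2 = q j * s φ j := by
        simp only [hq]
        rcases le_total (s φ j) 0 with h | h
        · simp [max_eq_right h]
        · simp [max_eq_left h, sq]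
      rw [this]
      simp only [s]
      rw [mul_sub, Finset.mul_sum]
      congr 1
      exact Finset.sum_congr rfl fun i _ => by ring
    have f3 : ∑ i, p i * a i + ∑ j, q j * b j
        = ∑ i, ∑ j, (p i - q j) * (ψ i j - φ i j) * η i j := by
      have g1 : ∑ i, p i * a i = ∑ i, ∑ j, p i * ((ψ i j - φ i j) * η i j) := by
        simp only [a, Finset.mul_sum]
      have g2 : ∑ j, q j * b j = - ∑ i, ∑ j, q j * ((ψ i j - φ i j) * η i j) := by
        simp only [b, Finset.mul_sum, mul_neg, Finset.sum_neg_distrib]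
        rw [Finset.sum_comm]
      rw [g1, g2, ← sub_eq_add_neg, ← Finset.sum_sub_distrib]
      refine Finset.sum_congr rfl fun i _ => ?_
      rw [← Finset.sum_sub_distrib]
      exact Finset.sum_congr rfl fun j _ => by ring
    have f4 : ∑ i, ∑ j, min (p i) (q j) * η i j
        = ∑ i, ∑ j, p i * φ i j * η i j + ∑ i, ∑ j, q j * (1 - φ i j) * η i j
          + ∑ i, ∑ j, (p i - q j) * (ψ i j - φ i j) * η i j := by
      rw [← Finset.sum_add_distrib, ← Finset.sum_add_distrib]
      refine Finset.sum_congr rfl fun i _ => ?_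
      rw [← Finset.sum_add_distrib, ← Finset.sum_add_distrib]
      refine Finset.sum_congr rfl fun j _ => ?_
      by_cases h : p i < q j
      · rw [min_eq_left h.le]; simp only [ψ, h, if_true]; ring
      · rw [min_eq_right (not_lt.1 h)]; simp only [ψ, h, if_false]; ring
    -- By `f1`, `f2`, `f4` the squares sum to the layer-cake sum minus the derivative `f3` minus ∑ p
    -- m + ∑ q n; `hder` and `hlayer` make this nonpositive.
    linarith
  have hp0 : ∑ i, p i ^ 2 = 0 := by
    have h1 : 0 ≤ ∑ i, p i ^ 2 := by positivity
    have h2 : 0 ≤ ∑ j, q j ^ 2 := by positivity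
    linarith
  have hq0 : ∑ j, q j ^ 2 = 0 := by
    have h1 : 0 ≤ ∑ i, p i ^ 2 := by positivity
    have h2 : 0 ≤ ∑ j, q j ^ 2 := by positivity
    linarith
  refine ⟨φ, fun i j => ⟨hφ.1 i j, hφ.2 i j⟩, fun i => ?_, fun j => ?_⟩
  · have := (Finset.sum_eq_zero_iff_of_nonneg fun i _ => sq_nonneg (p i)).1 hp0 i
      (Finset.mem_univ _)
    have h0 : p i = 0 := by simpa using this
    have : r φ i ≤ 0 := h0 ▸ le_max_left _ _
    simp only [r] at this; linarith
  · have := (Finset.sum_eq_zero_iff_of_nonneg fun i _ => sq_nonneg (q i)).1 hq0 j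
      (Finset.mem_univ _)
    have h0 : q j = 0 := by simpa using this
    have : s φ j ≤ 0 := h0 ▸ le_max_left _ _
    simp only [s] at this; linarith

/-! ### From finite grids to measures by compactness. -/

open Filter Topology in
/-- A finitely additive set function dominated by a σ-finite measure agrees with a measure on
each piece of a countable partition into sets of finite measure. -/
theorem exists_measure_apply_eq_tsum {α : Type*} [MeasurableSpace α] (η : Measure α)
    (D : ℕ → Set α) (hD : ∀ k, MeasurableSet (D k)) (hfin : ∀ k, η (D k) ≠ ∞)
    (L : Set α → ℝ≥0∞)
    (hadd : ∀ A B, MeasurableSet A → MeasurableSet B → Disjoint A B → L (A ∪ B) = L A + L B)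
    (hle : ∀ A, MeasurableSet A → L A ≤ η A) :
    ∃ σ : Measure α, ∀ A, MeasurableSet A → σ A = ∑' k, L (A ∩ D k) := by
  have hempty : L ∅ = 0 := le_antisymm ((hle ∅ .empty).trans_eq measure_empty) bot_le
  -- Finite additivity leaves a remainder dominated by the η-measure of a tail; within a piece of
  -- finite measure these tails decrease to the empty set and their measures to 0.
  have key : ∀ k, ∀ f : ℕ → Set α, (∀ i, MeasurableSet (f i)) → Pairwise (Function.onFun Disjoint f) →
      L ((⋃ i, f i) ∩ D k) = ∑' i, L (f i ∩ D k) := by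
    intro k f hf hdisj
    have hsum : ∀ n, L ((⋃ i ∈ Finset.range n, f i) ∩ D k)
        = ∑ i ∈ Finset.range n, L (f i ∩ D k) := by
      intro n
      induction n with
      | zero => simp [hempty]
      | succ n ih =>
        rw [Finset.sum_range_succ, ← ih, Finset.range_add_one, Finset.set_biUnion_insert,
          Set.union_comm, Set.union_inter_distrib_right]
        refine hadd _ _ ((Finset.measurableSet_biUnion _ fun i _ => hf i).inter (hD k))
          ((hf n).inter (hD k)) ?_
        refine Disjoint.mono Set.inter_subset_left Set.inter_subset_left ?_
        simp only [Set.disjoint_iUnion_left]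
        intro i hi
        exact hdisj (Finset.mem_range.1 hi).ne
    have hsplit : ∀ n, L ((⋃ i, f i) ∩ D k) = ∑ i ∈ Finset.range n, L (f i ∩ D k)
        + L (((⋃ i, f i) ∩ D k) \ (⋃ i ∈ Finset.range n, f i)) := by
      intro n
      have hm : MeasurableSet (⋃ i ∈ Finset.range n, f i) :=
        Finset.measurableSet_biUnion _ fun i _ => hf i
      rw [← hsum, ← hadd _ _ (hm.inter (hD k)) (((MeasurableSet.iUnion hf).inter (hD k)).diff hm)]
      · congr 1
        ext x
        simp only [Set.mem_union, Set.mem_inter_iff, Set.mem_iUnion, Set.mem_sdiff]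
        constructor
        · rintro ⟨⟨i, hi⟩, h2⟩
          by_cases h : ∃ i, ∃ (_ : i ∈ Finset.range n), x ∈ f i
          · exact Or.inl ⟨h, h2⟩
          · exact Or.inr ⟨⟨⟨i, hi⟩, h2⟩, h⟩
        · rintro (⟨⟨i, _, hi⟩, h2⟩ | ⟨h, _⟩)
          · exact ⟨⟨i, hi⟩, h2⟩
          · exact h
      · exact Set.disjoint_left.2 fun x h1 h2 => h2.2 h1.1
    have hrest : Tendsto (fun n => L (((⋃ i, f i) ∩ D k) \ (⋃ i ∈ Finset.range n, f i)))
        atTop (𝓝 0) := by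
      have hη : Tendsto (fun n => η (((⋃ i, f i) ∩ D k) \ (⋃ i ∈ Finset.range n, f i)))
          atTop (𝓝 (η (⋂ n, ((⋃ i, f i) ∩ D k) \ (⋃ i ∈ Finset.range n, f i)))) := by
        refine tendsto_measure_iInter_atTop (fun n => (((MeasurableSet.iUnion hf).inter
          (hD k)).diff (Finset.measurableSet_biUnion _ fun i _ => hf i)).nullMeasurableSet) ?_
          ⟨0, ?_⟩
        · intro m n hmn
          refine Set.sdiff_subset_sdiff_right ?_
          exact Set.biUnion_subset_biUnion_left fun i hi =>
            Finset.range_mono hmn hi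
        · exact ne_top_of_le_ne_top (hfin k)
            (measure_mono (Set.sdiff_subset.trans Set.inter_subset_right))
      have h0 : (⋂ n, ((⋃ i, f i) ∩ D k) \ (⋃ i ∈ Finset.range n, f i)) = ∅ := by
        refine Set.eq_empty_of_forall_notMem fun x hx => ?_
        rw [Set.mem_iInter] at hx
        obtain ⟨i, hi⟩ := Set.mem_iUnion.1 (hx 0).1.1
        exact (hx (i + 1)).2 (Set.mem_biUnion (x := i) (by simp) hi)
      rw [h0, measure_empty] at hη
      exact tendsto_of_tendsto_of_tendsto_of_le_of_le tendsto_const_nhds hη (fun _ => bot_le)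
        fun n => hle _ (((MeasurableSet.iUnion hf).inter
          (hD k)).diff (Finset.measurableSet_biUnion _ fun i _ => hf i))
    have ht := (ENNReal.tendsto_nat_tsum fun i => L (f i ∩ D k)).add hrest
    rw [add_zero] at ht
    refine tendsto_nhds_unique ?_ ht
    simp only [← hsplit]
    exact tendsto_const_nhds
  refine ⟨Measure.ofMeasurable (fun A _ => ∑' k, L (A ∩ D k)) (by simp [hempty]) ?_, ?_⟩
  · intro f hf hdisj
    simp only [fun k => key k f hf hdisj]
    exact ENNReal.tsum_comm
  · intro A hA
    rw [Measure.ofMeasurable_apply _ hA]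

theorem measureReal_preimage_eq_sum {X K : Type*} [MeasurableSpace X] [Fintype K]
    (κ : Measure X) [IsFiniteMeasure κ] (r : X → K) (hr : ∀ A : Set K, MeasurableSet (r ⁻¹' A))
    (A : Set K) : κ.real (r ⁻¹' A) = ∑ i, A.indicator 1 i * κ.real (r ⁻¹' {i}) := by
  classical
  have : r ⁻¹' A = ⋃ x ∈ Finset.univ.filter (· ∈ A), r ⁻¹' {x} := by
    ext x; simp
  rw [this, measureReal_biUnion_finset, Finset.sum_filter]
  · refine Finset.sum_congr rfl fun i _ => ?_
    by_cases h1 : i ∈ A <;> simp [h1]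
  · intro x _ y _ hxy
    exact Set.disjoint_left.2 fun z h1 h2 => hxy (h1.symm.trans h2)
  · exact fun x _ => hr _

theorem measureReal_preimage_prod_eq_sum {M N I J : Type*} [MeasurableSpace M]
    [MeasurableSpace N] [Fintype I] [Fintype J] (κ : Measure (M × N)) [IsFiniteMeasure κ]
    (p : M → I) (q : N → J) (hp : ∀ A : Set I, MeasurableSet (p ⁻¹' A))
    (hq : ∀ B : Set J, MeasurableSet (q ⁻¹' B)) (A : Set I) (B : Set J) :
    κ.real ((p ⁻¹' A) ×ˢ (q ⁻¹' B))
      = ∑ i, ∑ j, A.indicator 1 i * B.indicator 1 j * κ.real ((p ⁻¹' {i}) ×ˢ (q ⁻¹' {j})) := by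
  classical
  have : (p ⁻¹' A) ×ˢ (q ⁻¹' B) = ⋃ x ∈ Finset.univ.filter (fun x : I × J => x.1 ∈ A ∧ x.2 ∈ B),
      (p ⁻¹' {x.1}) ×ˢ (q ⁻¹' {x.2}) := by
    ext ⟨x, y⟩; simp
  rw [this, measureReal_biUnion_finset, Finset.sum_filter, Fintype.sum_prod_type]
  · refine Finset.sum_congr rfl fun i _ => Finset.sum_congr rfl fun j _ => ?_
    by_cases h1 : i ∈ A <;> by_cases h2 : j ∈ B <;> simp [h1, h2]
  · intro x _ y _ hxy
    refine Set.disjoint_left.2 fun z h1 h2 => hxy ?_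
    simp only [Set.mem_prod, Set.mem_preimage, Set.mem_singleton_iff] at h1 h2
    exact Prod.ext (h1.1.symm.trans h2.1) (h1.2.symm.trans h2.2)
  · exact fun x _ => (hp _).prod (hq _)

/-- Splitting a finite measure relative to finite partitions of the two factors. -/
theorem exists_split_of_fintype {M N I J : Type*} [MeasurableSpace M] [MeasurableSpace N]
    [Fintype I] [Fintype J] (μ : Measure M) (ν : Measure N) [IsFiniteMeasure μ]
    [IsFiniteMeasure ν] (η : Measure (M × N)) [IsFiniteMeasure η]
    (h : ∀ E F, MeasurableSet E → MeasurableSet F → η (E ×ˢ F) ≤ μ E + ν F)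
    (p : M → I) (q : N → J) (hp : ∀ A : Set I, MeasurableSet (p ⁻¹' A))
    (hq : ∀ B : Set J, MeasurableSet (q ⁻¹' B)) :
    ∃ σ τ : Measure (M × N), σ + τ = η ∧ (∀ A : Set I, σ ((p ⁻¹' A) ×ˢ Set.univ) ≤ μ (p ⁻¹' A)) ∧
      ∀ B : Set J, τ (Set.univ ×ˢ (q ⁻¹' B)) ≤ ν (q ⁻¹' B) := by
  classical
  obtain ⟨φ, hφ, hrow, hcol⟩ := exists_split_of_forall_rectangle
    (fun i j => η.real ((p ⁻¹' {i}) ×ˢ (q ⁻¹' {j}))) (fun i => μ.real (p ⁻¹' {i}))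
    (fun j => ν.real (q ⁻¹' {j})) (by
      intro A B
      rw [← measureReal_preimage_prod_eq_sum η p q hp hq, ← measureReal_preimage_eq_sum μ p hp,
        ← measureReal_preimage_eq_sum ν q hq]
      simp only [Measure.real]
      rw [← ENNReal.toReal_add (measure_ne_top _ _) (measure_ne_top _ _)]
      exact ENNReal.toReal_mono (by simp) (h _ _ (hp A) (hq B)))
  let _ : MeasurableSpace I := ⊤
  let _ : MeasurableSpace J := ⊤
  have hpm : Measurable p := fun A _ => hp A
  have hqm : Measurable q := fun A _ => hq A
  have hPm : Measurable fun z : M × N => (p z.1, q z.2) :=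
    (hpm.comp measurable_fst).prodMk (hqm.comp measurable_snd)
  have hd : ∀ g : I → J → ℝ, Measurable fun z : M × N => ENNReal.ofReal (g (p z.1) (q z.2)) :=
    fun g => (measurable_of_finite (fun k : I × J => ENNReal.ofReal (g k.1 k.2))).comp hPm
  have hcell : ∀ (g : I → J → ℝ) (_ : ∀ i j, 0 ≤ g i j) (i : I) (j : J),
      (η.withDensity fun z => ENNReal.ofReal (g (p z.1) (q z.2))).real
        ((p ⁻¹' {i}) ×ˢ (q ⁻¹' {j})) = g i j * η.real ((p ⁻¹' {i}) ×ˢ (q ⁻¹' {j})) := by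
    intro g hg i j
    have hm : MeasurableSet ((p ⁻¹' {i}) ×ˢ (q ⁻¹' {j}) : Set (M × N)) := (hp _).prod (hq _)
    rw [Measure.real, withDensity_apply _ hm, setLIntegral_congr_fun hm
      (g := fun _ => ENNReal.ofReal (g i j)), setLIntegral_const, ENNReal.toReal_mul,
      ENNReal.toReal_ofReal (hg i j), Measure.real]
    rintro ⟨x, y⟩ hz
    simp only [Set.mem_prod, Set.mem_preimage, Set.mem_singleton_iff] at hz
    simp only [hz.1, hz.2]
  -- The grid weight, constant on each cell, and its complement to 1 serve as densities with respect
  -- to η.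
  have hadd : η.withDensity (fun z => ENNReal.ofReal (φ (p z.1) (q z.2)))
      + η.withDensity (fun z => ENNReal.ofReal (1 - φ (p z.1) (q z.2))) = η := by
    rw [← withDensity_add_left (hd φ)]
    conv_rhs => rw [← withDensity_one (μ := η)]
    congr 1
    funext z
    simp only [Pi.add_apply, Pi.one_apply]
    rw [← ENNReal.ofReal_add (hφ _ _).1 (by linarith [(hφ (p z.1) (q z.2)).2])]
    simp
  have hf1 : IsFiniteMeasure (η.withDensity fun z => ENNReal.ofReal (φ (p z.1) (q z.2))) :=
    isFiniteMeasure_of_le η (by conv_rhs => rw [← hadd]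
                                exact Measure.le_add_right le_rfl)
  have hf2 : IsFiniteMeasure (η.withDensity fun z => ENNReal.ofReal (1 - φ (p z.1) (q z.2))) :=
    isFiniteMeasure_of_le η (by conv_rhs => rw [← hadd]
                                exact Measure.le_add_left le_rfl)
  refine ⟨_, _, hadd, fun A => ?_, fun B => ?_⟩
  · rw [← ENNReal.toReal_le_toReal (measure_ne_top _ _) (measure_ne_top _ _)]
    change Measure.real _ _ ≤ μ.real _
    rw [measureReal_preimage_eq_sum μ p hp, ← Set.preimage_univ (f := q),
      measureReal_preimage_prod_eq_sum _ p q hp hq]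
    refine Finset.sum_le_sum fun i _ => ?_
    simp only [hcell φ (fun i j => (hφ i j).1), Set.indicator_univ, Pi.one_apply, mul_one]
    rw [← Finset.mul_sum]
    exact mul_le_mul_of_nonneg_left (hrow i) (Set.indicator_nonneg (fun _ _ => zero_le_one) _)
  · rw [← ENNReal.toReal_le_toReal (measure_ne_top _ _) (measure_ne_top _ _)]
    change Measure.real _ _ ≤ ν.real _
    rw [measureReal_preimage_eq_sum ν q hq, ← Set.preimage_univ (f := p),
      measureReal_preimage_prod_eq_sum _ p q hp hq, Finset.sum_comm]
    refine Finset.sum_le_sum fun j _ => ?_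
    simp only [hcell (fun i j => 1 - φ i j) (fun i j => by linarith [(hφ i j).2]),
      Set.indicator_univ, Pi.one_apply, one_mul]
    rw [← Finset.mul_sum]
    exact mul_le_mul_of_nonneg_left (hcol j) (Set.indicator_nonneg (fun _ _ => zero_le_one) _)

/-- Splitting a finite measure relative to finitely many measurable sets. -/
theorem exists_split_of_finset {M N : Type*} [MeasurableSpace M] [MeasurableSpace N]
    (μ : Measure M) (ν : Measure N) [IsFiniteMeasure μ]
    [IsFiniteMeasure ν] (η : Measure (M × N)) [IsFiniteMeasure η]
    (h : ∀ E F, MeasurableSet E → MeasurableSet F → η (E ×ˢ F) ≤ μ E + ν F)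
    (𝓔 : Finset {E : Set M // MeasurableSet E}) (𝓕 : Finset {F : Set N // MeasurableSet F}) :
    ∃ σ τ : Measure (M × N), σ + τ = η ∧ (∀ E ∈ 𝓔, σ (E.1 ×ˢ Set.univ) ≤ μ E.1) ∧
      ∀ F ∈ 𝓕, τ (Set.univ ×ˢ F.1) ≤ ν F.1 := by
  classical
  -- Points are classified by their membership pattern in the finite family, so each member is the
  -- preimage of a set of patterns.
  obtain ⟨σ, τ, h1, h2, h3⟩ := exists_split_of_fintype μ ν η h
    (I := 𝓔 → Prop) (J := 𝓕 → Prop) (fun x E => x ∈ E.1.1) (fun y F => y ∈ F.1.1)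
    (fun A => measurable_pi_lambda _ (fun E => measurable_mem.2 E.1.2) (Set.toFinite A).measurableSet)
    (fun A => measurable_pi_lambda _ (fun E => measurable_mem.2 E.1.2) (Set.toFinite A).measurableSet)
  exact ⟨σ, τ, h1, fun E hE => h2 {k | k ⟨E, hE⟩}, fun F hF => h3 {k | k ⟨F, hF⟩}⟩

open Filter Topology in
/-- A measure on a product of σ-finite spaces that satisfies `η (E × F) ≤ μ E + ν F` on all
rectangles is a sum of two measures whose marginals are dominated by `μ` and `ν`. -/
theorem exists_add_eq_of_forall_rectangle {M N : Type*} [MeasurableSpace M] [MeasurableSpace N]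
    (μ : Measure M) (ν : Measure N) [SigmaFinite μ] [SigmaFinite ν] (η : Measure (M × N))
    (h : ∀ E F, MeasurableSet E → MeasurableSet F → μ E < ∞ → ν F < ∞ →
      η (E ×ˢ F) ≤ μ E + ν F) :
    SigmaFinite η ∧ ∃ σ τ : Measure (M × N), σ + τ = η ∧
      (∀ E, MeasurableSet E → σ (E ×ˢ Set.univ) ≤ μ E) ∧
      ∀ F, MeasurableSet F → τ (Set.univ ×ˢ F) ≤ ν F := by
  classical
  let X := spanningSets μ
  let Y := spanningSets ν
  have hX : ∀ n, MeasurableSet (X n) := measurableSet_spanningSets μ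
  have hY : ∀ n, MeasurableSet (Y n) := measurableSet_spanningSets ν
  have hXY : ∀ n, η (X n ×ˢ Y n) < ∞ := fun n =>
    (h _ _ (hX n) (hY n) (measure_spanningSets_lt_top _ _) (measure_spanningSets_lt_top _ _)).trans_lt
      (ENNReal.add_lt_top.2 ⟨measure_spanningSets_lt_top _ _, measure_spanningSets_lt_top _ _⟩)
  have hmono : Monotone fun n => X n ×ˢ Y n := fun m n hmn =>
    Set.prod_mono (monotone_spanningSets μ hmn) (monotone_spanningSets ν hmn)
  have hUnion : ⋃ n, X n ×ˢ Y n = Set.univ := by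
    refine Set.eq_univ_of_forall fun z => ?_
    obtain ⟨m, hm⟩ := Set.mem_iUnion.1 ((iUnion_spanningSets μ).symm ▸ Set.mem_univ z.1)
    obtain ⟨n, hn⟩ := Set.mem_iUnion.1 ((iUnion_spanningSets ν).symm ▸ Set.mem_univ z.2)
    exact Set.mem_iUnion.2 ⟨max m n, monotone_spanningSets μ (le_max_left m n) hm,
      monotone_spanningSets ν (le_max_right m n) hn⟩
  have hsf : SigmaFinite η := ⟨⟨⟨fun n => X n ×ˢ Y n, fun _ => trivial, hXY, hUnion⟩⟩⟩
  refine ⟨hsf, ?_⟩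
  -- The directed index records a truncation level, which makes all measures finite, and the
  -- finitely many sets on which the marginals are controlled.
  let ι := ℕ × Finset {E : Set M // MeasurableSet E} × Finset {F : Set N // MeasurableSet F}
  have hex : ∀ i : ι, ∃ σ τ : Measure (M × N), σ + τ = η.restrict (X i.1 ×ˢ Y i.1) ∧
      (∀ E ∈ i.2.1, σ (E.1 ×ˢ Set.univ) ≤ μ E.1) ∧
      ∀ F ∈ i.2.2, τ (Set.univ ×ˢ F.1) ≤ ν F.1 := by
    intro i
    have f1 : IsFiniteMeasure (μ.restrict (X i.1)) :=
      ⟨by simpa using measure_spanningSets_lt_top μ i.1⟩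
    have f2 : IsFiniteMeasure (ν.restrict (Y i.1)) :=
      ⟨by simpa using measure_spanningSets_lt_top ν i.1⟩
    have f3 : IsFiniteMeasure (η.restrict (X i.1 ×ˢ Y i.1)) := ⟨by simpa using hXY i.1⟩
    obtain ⟨σ, τ, h1, h2, h3⟩ := exists_split_of_finset (μ.restrict (X i.1)) (ν.restrict (Y i.1))
      (η.restrict (X i.1 ×ˢ Y i.1)) (by
        intro E F hE hF
        rw [Measure.restrict_apply (hE.prod hF), Measure.restrict_apply hE,
          Measure.restrict_apply hF, Set.prod_inter_prod]
        exact h _ _ (hE.inter (hX _)) (hF.inter (hY _))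
          ((measure_mono Set.inter_subset_right).trans_lt (measure_spanningSets_lt_top _ _))
          ((measure_mono Set.inter_subset_right).trans_lt (measure_spanningSets_lt_top _ _)))
      i.2.1 i.2.2
    exact ⟨σ, τ, h1, fun E hE => (h2 E hE).trans (Measure.restrict_apply_le _ _),
      fun F hF => (h3 F hF).trans (Measure.restrict_apply_le _ _)⟩
  choose s t hst hs ht using hex
  let U : Ultrafilter ι := Ultrafilter.of atTop
  have hU : (U : Filter ι) ≤ atTop := Ultrafilter.of_le _
  have hlim : ∀ κ : ι → Measure (M × N), ∃ L : Set (M × N) → ℝ≥0∞,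
      ∀ A, Tendsto (fun i => κ i A) U (𝓝 (L A)) := fun κ =>
    -- Limits along the ultrafilter exist for every set at once because `ℝ≥0∞` is compact.
    ⟨fun A => (U.map fun i => κ i A).lim, fun A => (U.map fun i => κ i A).le_nhds_lim⟩
  obtain ⟨S, hS⟩ := hlim s
  obtain ⟨T, hT⟩ := hlim t
  have hη : ∀ A, MeasurableSet A → Tendsto (fun i : ι => η.restrict (X i.1 ×ˢ Y i.1) A) U
      (𝓝 (η A)) := by
    intro A hA
    have h1 : Tendsto (fun n => η (A ∩ X n ×ˢ Y n)) atTop (𝓝 (η A)) := by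
      have := tendsto_measure_iUnion_atTop (μ := η) (s := fun n => A ∩ X n ×ˢ Y n)
        (fun m n hmn => Set.inter_subset_inter_right _ (hmono hmn))
      rwa [← Set.inter_iUnion, hUnion, Set.inter_univ] at this
    have h2 : Tendsto (fun i : ι => i.1) U atTop := by
      refine Tendsto.mono_left ?_ hU
      rw [← prod_atTop_atTop_eq]
      exact tendsto_fst
    simpa only [Function.comp_def, Measure.restrict_apply hA] using h1.comp h2
  have hSTη : ∀ A, MeasurableSet A → S A + T A = η A := fun A hA =>
    tendsto_nhds_unique (((hS A).add (hT A)).congr fun i => by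
      rw [← hst i, Measure.add_apply]) (hη A hA)
  have haddL : ∀ (κ : ι → Measure (M × N)) (L : Set (M × N) → ℝ≥0∞)
      (_ : ∀ A, Tendsto (fun i => κ i A) U (𝓝 (L A))) (A B : Set (M × N)), MeasurableSet A →
      MeasurableSet B → Disjoint A B → L (A ∪ B) = L A + L B := by
    intro κ L hL A B _ hB hAB
    refine tendsto_nhds_unique (hL _) (((hL A).add (hL B)).congr fun i => ?_)
    rw [measure_union hAB hB]
  let D := disjointed (spanningSets η)
  have hD : ∀ k, MeasurableSet (D k) := MeasurableSet.disjointed (measurableSet_spanningSets η)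
  have hDfin : ∀ k, η (D k) ≠ ∞ := fun k =>
    ((measure_mono (disjointed_subset _ k)).trans_lt (measure_spanningSets_lt_top η k)).ne
  have hDdisj : Pairwise (Function.onFun Disjoint D) := disjoint_disjointed _
  have hDU : ⋃ k, D k = Set.univ := (iUnion_disjointed).trans (iUnion_spanningSets η)
  -- Reassembling a limit from the pieces can only lose mass, so the marginal bounds survive; the
  -- sum loses nothing, since S + T is the countably additive η.
  have hsumle : ∀ (κ : ι → Measure (M × N)) (L : Set (M × N) → ℝ≥0∞)
      (_ : ∀ A, Tendsto (fun i => κ i A) U (𝓝 (L A))) (A : Set (M × N)), MeasurableSet A →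
      ∑' k, L (A ∩ D k) ≤ L A := by
    intro κ L hL A hA
    rw [ENNReal.tsum_eq_iSup_nat]
    refine iSup_le fun n => ?_
    refine le_of_tendsto_of_tendsto' (tendsto_finsetSum _ fun k _ => hL (A ∩ D k)) (hL A)
      fun i => ?_
    rw [← measure_biUnion_finset (fun j _ k _ hjk => (hDdisj hjk).mono Set.inter_subset_right
      Set.inter_subset_right) fun k _ => hA.inter (hD k)]
    exact measure_mono (Set.iUnion₂_subset fun k _ => Set.inter_subset_left)
  obtain ⟨σ, hσ⟩ := exists_measure_apply_eq_tsum η D hD hDfin S (haddL s S hS)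
    fun A hA => (hSTη A hA) ▸ le_self_add
  obtain ⟨τ, hτ⟩ := exists_measure_apply_eq_tsum η D hD hDfin T (haddL t T hT)
    fun A hA => (hSTη A hA) ▸ le_add_self
  refine ⟨σ, τ, ?_, fun E hE => ?_, fun F hF => ?_⟩
  · ext A hA
    rw [Measure.add_apply, hσ A hA, hτ A hA, ← ENNReal.tsum_add]
    simp only [hSTη _ (hA.inter (hD _))]
    rw [← measure_iUnion (fun j k hjk => (hDdisj hjk).mono Set.inter_subset_right
      Set.inter_subset_right) fun k => hA.inter (hD k), ← Set.inter_iUnion, hDU, Set.inter_univ]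
  · have hm : MeasurableSet (E ×ˢ Set.univ : Set (M × N)) := hE.prod .univ
    rw [hσ _ hm]
    refine (hsumle s S hS _ hm).trans (le_of_tendsto (hS _) ?_)
    -- Beyond this index every finite family contains E, so the marginal bound for E holds
    -- eventually.
    filter_upwards [hU (eventually_ge_atTop ((0, {⟨E, hE⟩}, ∅) : ι))] with i hi
    exact hs i ⟨E, hE⟩ (hi.2.1 (Finset.mem_singleton_self _))
  · have hm : MeasurableSet (Set.univ ×ˢ F : Set (M × N)) := MeasurableSet.univ.prod hF
    rw [hτ _ hm]
    refine (hsumle t T hT _ hm).trans (le_of_tendsto (hT _) ?_)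
    filter_upwards [hU (eventually_ge_atTop ((0, ∅, {⟨F, hF⟩}) : ι))] with i hi
    exact ht i ⟨F, hF⟩ (hi.2.2 (Finset.mem_singleton_self _))

/-- The measure with density h splits into σ + τ, and φ, ψ are their Radon–Nikodym derivatives with
respect to it. The identity φ + ψ = 1 is thus available only where h is nonzero. Marginal bounds on
all measurable sets become almost everywhere bounds on fibre integrals. -/
theorem exists_density_split {M N : Type*} [MeasurableSpace M] [MeasurableSpace N]
    (μ : Measure M) (ν : Measure N) [SigmaFinite μ] [SigmaFinite ν] (h : M × N → ℝ≥0∞)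
    (hh : Measurable h) (a b : NNReal)
    (hr : ∀ E F, MeasurableSet E → MeasurableSet F →
      ∫⁻ z in E ×ˢ F, h z ∂(μ.prod ν) ≤ a * μ E + b * ν F) :
    ∃ φ ψ : M × N → ℝ≥0∞, Measurable φ ∧ Measurable ψ ∧
      (∀ᵐ z ∂(μ.prod ν), h z ≠ 0 → φ z + ψ z = 1) ∧
      (∀ᵐ x ∂μ, ∫⁻ y, h (x, y) * φ (x, y) ∂ν ≤ a) ∧
      ∀ᵐ y ∂ν, ∫⁻ x, h (x, y) * ψ (x, y) ∂μ ≤ b := by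
  have rect : ∀ E F, MeasurableSet E → MeasurableSet F →
      (μ.prod ν).withDensity h (E ×ˢ F) ≤ (a • μ) E + (b • ν) F := by
    intro E F hE hF
    rw [withDensity_apply _ (hE.prod hF)]
    exact hr E F hE hF
  obtain ⟨hsf, σ, τ, hadd, h1, h2⟩ := exists_add_eq_of_forall_rectangle (a • μ) (b • ν) _
    fun E F hE hF _ _ => rect E F hE hF
  set η := (μ.prod ν).withDensity h with hη
  have hσ : σ ≤ η := hadd ▸ Measure.le_add_right le_rfl
  have hτ : τ ≤ η := hadd ▸ Measure.le_add_left le_rfl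
  have sσ : SigmaFinite σ := Measure.sigmaFinite_of_le η hσ
  have sτ : SigmaFinite τ := Measure.sigmaFinite_of_le η hτ
  have mφ := Measure.measurable_rnDeriv σ η
  have mψ := Measure.measurable_rnDeriv τ η
  have key : ∀ κ : Measure (M × N), κ ≤ η → SigmaFinite κ →
      κ = (μ.prod ν).withDensity (h * κ.rnDeriv η) := by
    intro κ hκ _
    rw [withDensity_mul _ hh (Measure.measurable_rnDeriv κ η),
      Measure.withDensity_rnDeriv_eq κ η (Measure.absolutelyContinuous_of_le hκ)]
  refine ⟨σ.rnDeriv η, τ.rnDeriv η, mφ, mψ, ?_, ?_, ?_⟩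
  · have e1 := Measure.rnDeriv_add' σ τ η
    have e2 := Measure.rnDeriv_self η
    rw [hadd] at e1
    have e3 : ∀ᵐ z ∂η, σ.rnDeriv η z + τ.rnDeriv η z = 1 := by
      filter_upwards [e1, e2] with z f1 f2
      rw [← f2, f1, Pi.add_apply]
    exact (ae_withDensity_iff hh).1 e3
  · refine ae_le_of_forall_setLIntegral_le_of_sigmaFinite
      (Measurable.lintegral_prod_right' (f := fun z => h z * σ.rnDeriv η z) (hh.mul mφ))
      fun E hE _ => ?_
    have := h1 E hE
    rw [key σ hσ sσ, withDensity_apply _ (hE.prod .univ), ← Measure.prod_restrict,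
      Measure.restrict_univ, lintegral_prod _ (hh.mul mφ).aemeasurable] at this
    simpa [setLIntegral_const] using this
  · refine ae_le_of_forall_setLIntegral_le_of_sigmaFinite
      (Measurable.lintegral_prod_left' (f := fun z => h z * τ.rnDeriv η z) (hh.mul mψ))
      fun F hF _ => ?_
    have := h2 F hF
    rw [key τ hτ sτ, withDensity_apply _ (MeasurableSet.univ.prod hF), ← Measure.prod_restrict,
      Measure.restrict_univ, lintegral_prod_symm _ (hh.mul mψ).aemeasurable] at this
    simpa [setLIntegral_const] using this

/-! ### Jointly measurable functions as strongly measurable `L¹`-valued functions. -/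

section SectionL1

open Filter Topology

variable {𝕜 : Type*} [RCLike 𝕜] {M N : Type*} [MeasurableSpace N]

open scoped Classical in
/-- The class in `L¹` of the section `g (x, ·)`, or `0` if this section is not integrable. -/
noncomputable def sectionL1 (ν : Measure N) (g : M × N → 𝕜) (x : M) : Lp 𝕜 1 ν :=
  if h : Integrable (fun y => g (x, y)) ν then h.toL1 _ else 0

variable {ν : Measure N}

theorem sectionL1_of_integrable {g : M × N → 𝕜} {x : M}
    (h : Integrable (fun y => g (x, y)) ν) : sectionL1 ν g x = h.toL1 _ := dif_pos h

theorem sectionL1_add {g k : M × N → 𝕜} (hg : ∀ x, Integrable (fun y => g (x, y)) ν)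
    (hk : ∀ x, Integrable (fun y => k (x, y)) ν) :
    sectionL1 ν (fun z => g z + k z) = fun x => sectionL1 ν g x + sectionL1 ν k x := by
  funext x
  rw [sectionL1_of_integrable (hg x), sectionL1_of_integrable (hk x),
    sectionL1_of_integrable ((hg x).add (hk x))]
  exact Integrable.toL1_add _ _ (hg x) (hk x)

theorem sectionL1_const_mul {g : M × N → 𝕜} (hg : ∀ x, Integrable (fun y => g (x, y)) ν)
    (c : 𝕜) : sectionL1 ν (fun z => c * g z) = fun x => c • sectionL1 ν g x := by
  funext x
  rw [sectionL1_of_integrable (hg x), sectionL1_of_integrable ((hg x).const_mul c)]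
  exact Integrable.toL1_smul _ (hg x) c

variable [MeasurableSpace M]

/-- Where the section of g is integrable, dominated convergence gives convergence in `L¹`; elsewhere
the approximants are cut to 0, the default value of `sectionL1`. -/
theorem stronglyMeasurable_sectionL1_of_tendsto {g : M × N → 𝕜} {k : ℕ → M × N → 𝕜}
    (hI : MeasurableSet {x | Integrable (fun y => g (x, y)) ν})
    (hk : ∀ n, Measurable (k n)) (hks : ∀ n, StronglyMeasurable (sectionL1 ν (k n)))
    (C : ℝ) (hbound : ∀ n z, ‖k n z‖ ≤ C * ‖g z‖)
    (hlim : ∀ z, Tendsto (fun n => k n z) atTop (𝓝 (g z))) :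
    StronglyMeasurable (sectionL1 ν g) := by
  refine stronglyMeasurable_of_tendsto atTop (fun n => (hks n).indicator hI) ?_
  refine tendsto_pi_nhds.2 fun x => ?_
  by_cases hx : Integrable (fun y => g (x, y)) ν
  · have hmem : x ∈ {x | Integrable (fun y => g (x, y)) ν} := hx
    simp only [Set.indicator_of_mem hmem]
    have hkm : ∀ n, AEStronglyMeasurable (fun y => k n (x, y)) ν := fun n =>
      ((hk n).comp measurable_prodMk_left).aestronglyMeasurable
    have hki : ∀ n, Integrable (fun y => k n (x, y)) ν := fun n =>
      (hx.norm.const_mul C).mono' (hkm n) (Eventually.of_forall fun y => hbound n (x, y))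
    simp only [fun n => sectionL1_of_integrable (hki n), sectionL1_of_integrable hx]
    rw [tendsto_iff_edist_tendsto_0]
    simp only [Integrable.edist_toL1_toL1]
    simp only [edist_eq_enorm_sub, ← ofReal_norm]
    exact tendsto_lintegral_norm_of_dominated_convergence (F := fun n y => k n (x, y)) hkm
      (hx.norm.const_mul C).2 (fun n => Eventually.of_forall fun y => hbound n (x, y))
      (Eventually.of_forall fun y => hlim (x, y))
  · have hmem : x ∉ {x | Integrable (fun y => g (x, y)) ν} := hx
    simp only [Set.indicator_of_notMem hmem]
    rw [sectionL1, dif_neg hx]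
    exact tendsto_const_nhds

theorem integrable_section_indicator {S : Set N} (hS : MeasurableSet S) (hfin : ν S ≠ ∞)
    {A : Set (M × N)} (hA : MeasurableSet A) (x : M) :
    Integrable (fun y => (A ∩ Set.univ ×ˢ S).indicator (1 : M × N → 𝕜) (x, y)) ν := by
  have : (fun y => (A ∩ Set.univ ×ˢ S).indicator (1 : M × N → 𝕜) (x, y))
      = (Prod.mk x ⁻¹' A ∩ S).indicator fun _ => (1 : 𝕜) := by
    funext y
    by_cases h1 : (x, y) ∈ A <;> by_cases h2 : y ∈ S <;> simp [h1, h2, Set.indicator]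
  rw [this, integrable_indicator_iff ((measurable_prodMk_left hA).inter hS)]
  exact integrableOn_const (ne_top_of_le_ne_top hfin (measure_mono Set.inter_subset_right))

/-- Induction from rectangles over the product σ-algebra, needed because `L¹` may be nonseparable.
The cut to S of finite measure keeps every section integrable, so complements and countable disjoint
unions can be taken. -/
theorem stronglyMeasurable_sectionL1_indicator {S : Set N} (hS : MeasurableSet S)
    (hfin : ν S ≠ ∞) {A : Set (M × N)} (hA : MeasurableSet A) :
    StronglyMeasurable (sectionL1 ν ((A ∩ Set.univ ×ˢ S).indicator (1 : M × N → 𝕜))) := by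
  have hmI : ∀ {B : Set (M × N)}, MeasurableSet B →
      Measurable ((B ∩ Set.univ ×ˢ S).indicator (1 : M × N → 𝕜)) := fun hB =>
    measurable_one.indicator (hB.inter (MeasurableSet.univ.prod hS))
  have hrect : ∀ (s : Set M) (t : Set N), MeasurableSet s → MeasurableSet t →
      StronglyMeasurable (sectionL1 ν ((s ×ˢ t ∩ Set.univ ×ˢ S).indicator (1 : M × N → 𝕜))) := by
    intro s t hs ht
    have hint : Integrable ((t ∩ S).indicator fun _ => (1 : 𝕜)) ν := by
      rw [integrable_indicator_iff (ht.inter hS)]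
      exact integrableOn_const (ne_top_of_le_ne_top hfin (measure_mono Set.inter_subset_right))
    have : sectionL1 ν ((s ×ˢ t ∩ Set.univ ×ˢ S).indicator (1 : M × N → 𝕜))
        = s.indicator fun _ => hint.toL1 _ := by
      funext x
      rw [sectionL1_of_integrable (integrable_section_indicator hS hfin (hs.prod ht) x)]
      by_cases hx : x ∈ s
      · rw [Set.indicator_of_mem hx]
        rw [Integrable.toL1_eq_toL1_iff]
        refine Eventually.of_forall fun y => ?_
        by_cases h1 : y ∈ t <;> by_cases h2 : y ∈ S <;> simp [hx, h1, h2, Set.indicator]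
      · rw [Set.indicator_of_notMem hx, ← Integrable.toL1_zero (integrable_zero N 𝕜 ν),
          Integrable.toL1_eq_toL1_iff]
        refine Eventually.of_forall fun y => ?_
        simp [hx, Set.indicator]
    rw [this]
    exact stronglyMeasurable_const.indicator hs
  induction A, hA using MeasurableSpace.induction_on_inter generateFrom_prod.symm isPiSystem_prod with
  | empty => simpa using hrect ∅ ∅ .empty .empty
  | basic u hu =>
    obtain ⟨s, hs, t, ht, rfl⟩ := hu
    exact hrect s t hs ht
  | compl B hB ih =>
    have huniv := hrect Set.univ Set.univ .univ .univ
    rw [Set.univ_prod_univ] at huniv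
    have hi := integrable_section_indicator (𝕜 := 𝕜) hS hfin hB
    have hu := integrable_section_indicator (𝕜 := 𝕜) (M := M) hS hfin MeasurableSet.univ
    have : (Bᶜ ∩ Set.univ ×ˢ S).indicator (1 : M × N → 𝕜)
        = fun z => (Set.univ ∩ Set.univ ×ˢ S).indicator (1 : M × N → 𝕜) z
          + (-1) * (B ∩ Set.univ ×ˢ S).indicator (1 : M × N → 𝕜) z := by
      funext z
      by_cases h1 : z ∈ B <;> by_cases h2 : z.2 ∈ S <;> simp [h1, h2, Set.indicator]
    rw [this, sectionL1_add hu fun x => (hi x).const_mul _, sectionL1_const_mul hi]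
    exact huniv.add (ih.const_smul (-1 : 𝕜))
  | iUnion f hd hf ih =>
    have hfin' : ∀ n, (∀ x, Integrable (fun y =>
        ∑ i ∈ Finset.range n, (f i ∩ Set.univ ×ˢ S).indicator (1 : M × N → 𝕜) (x, y)) ν) ∧
        StronglyMeasurable (sectionL1 ν fun z =>
          ∑ i ∈ Finset.range n, (f i ∩ Set.univ ×ˢ S).indicator (1 : M × N → 𝕜) z) := by
      intro n
      induction n with
      | zero =>
        refine ⟨fun x => by simp, ?_⟩
        simpa using hrect ∅ ∅ .empty .empty
      | succ n ihn =>
        simp only [Finset.sum_range_succ]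
        have hi := integrable_section_indicator (𝕜 := 𝕜) hS hfin (hf n)
        refine ⟨fun x => (ihn.1 x).add (hi x), ?_⟩
        rw [sectionL1_add ihn.1 hi]
        exact ihn.2.add (ih n)
    have hbU : ∀ z, HasSum (fun i => (f i ∩ Set.univ ×ˢ S).indicator (1 : M × N → 𝕜) z)
        (((⋃ i, f i) ∩ Set.univ ×ˢ S).indicator (1 : M × N → 𝕜) z) := by
      intro z
      by_cases hz : z ∈ (⋃ i, f i) ∩ Set.univ ×ˢ S
      · obtain ⟨i, hi⟩ := Set.mem_iUnion.1 hz.1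
        have : ((⋃ i, f i) ∩ Set.univ ×ˢ S).indicator (1 : M × N → 𝕜) z
            = (f i ∩ Set.univ ×ˢ S).indicator (1 : M × N → 𝕜) z := by
          rw [Set.indicator_of_mem hz,
            Set.indicator_of_mem (show z ∈ f i ∩ Set.univ ×ˢ S from ⟨hi, hz.2⟩)]
        rw [this]
        refine hasSum_single i fun j hj => Set.indicator_of_notMem (fun h => ?_) _
        exact Set.disjoint_left.1 (hd hj) h.1 hi
      · rw [Set.indicator_of_notMem hz]
        refine hasSum_zero.congr_fun fun i => ?_
        exact Set.indicator_of_notMem (fun h => hz ⟨Set.mem_iUnion.2 ⟨i, h.1⟩, h.2⟩) _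
    have hU := integrable_section_indicator (𝕜 := 𝕜) hS hfin (MeasurableSet.iUnion hf)
    refine stronglyMeasurable_sectionL1_of_tendsto (C := 1)
      (k := fun n z => ∑ i ∈ Finset.range n, (f i ∩ Set.univ ×ˢ S).indicator (1 : M × N → 𝕜) z)
      ?_ (fun n => Finset.measurable_fun_sum _ fun i _ => hmI (hf i))
      (fun n => (hfin' n).2) ?_ fun z => (hbU z).tendsto_sum_nat
    · simp only [hU, Set.ofPred_true, MeasurableSet.univ]
    · intro n z
      rw [one_mul]
      by_cases hz : ∃ i ∈ Finset.range n, z ∈ f i ∩ Set.univ ×ˢ S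
      · obtain ⟨i, hin, hi⟩ := hz
        rw [Finset.sum_eq_single_of_mem i hin fun j _ hj => Set.indicator_of_notMem
          (fun h => Set.disjoint_left.1 (hd hj) h.1 hi.1) _, Set.indicator_of_mem hi,
          Set.indicator_of_mem (show z ∈ (⋃ i, f i) ∩ Set.univ ×ˢ S from
            ⟨Set.mem_iUnion.2 ⟨i, hi.1⟩, hi.2⟩)]
      · rw [Finset.sum_eq_zero fun i hin => Set.indicator_of_notMem
          (fun h => hz ⟨i, hin, h⟩) _, norm_zero]
        exact norm_nonneg _

theorem stronglyMeasurable_sectionL1 {S : Set N} (hS : MeasurableSet S)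
    (hσ : SigmaFinite (ν.restrict S)) {g : M × N → 𝕜} (hg : Measurable g)
    (hsupp : ∀ x, ∀ y ∉ S, g (x, y) = 0) : StronglyMeasurable (sectionL1 ν g) := by
  let T : ℕ → Set N := fun n => S ∩ spanningSets (ν.restrict S) n
  have hT : ∀ n, MeasurableSet (T n) := fun n => hS.inter (measurableSet_spanningSets _ n)
  have hTfin : ∀ n, ν (T n) ≠ ∞ := fun n => by
    have := measure_spanningSets_lt_top (ν.restrict S) n
    rw [Measure.restrict_apply (measurableSet_spanningSets _ n), Set.inter_comm] at this
    exact this.ne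
  have hsimple : ∀ n (φ : SimpleFunc (M × N) 𝕜),
      (∀ x, Integrable (fun y => φ (x, y) * (Set.univ ∩ Set.univ ×ˢ T n).indicator (1 : M × N → 𝕜) (x, y)) ν) ∧
      StronglyMeasurable (sectionL1 ν fun z =>
        φ z * (Set.univ ∩ Set.univ ×ˢ T n).indicator (1 : M × N → 𝕜) z) := by
    intro n φ
    induction φ using SimpleFunc.induction with
    | const c hA =>
      rename_i A
      have hi := integrable_section_indicator (𝕜 := 𝕜) (hT n) (hTfin n) hA
      have heq : (fun z : M × N => (SimpleFunc.piecewise A hA (SimpleFunc.const (M × N) c) (SimpleFunc.const (M × N) (0 : 𝕜))) z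
          * (Set.univ ∩ Set.univ ×ˢ T n).indicator (1 : M × N → 𝕜) z)
          = fun z => c * (A ∩ Set.univ ×ˢ T n).indicator (1 : M × N → 𝕜) z := by
        funext z
        by_cases h1 : z ∈ A <;> by_cases h2 : z.2 ∈ T n <;> simp [h1, h2, Set.indicator]
      refine ⟨fun x => ?_, ?_⟩
      · have := (hi x).const_mul c
        refine this.congr (Eventually.of_forall fun y => ?_)
        exact (congrFun heq (x, y)).symm
      · rw [heq, sectionL1_const_mul hi]
        exact (stronglyMeasurable_sectionL1_indicator (𝕜 := 𝕜) (hT n) (hTfin n) hA).const_smul c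
    | add _ h1 h2 =>
      simp only [SimpleFunc.coe_add, Pi.add_apply, add_mul]
      refine ⟨fun x => (h1.1 x).add (h2.1 x), ?_⟩
      rw [sectionL1_add h1.1 h2.1]
      exact h1.2.add h2.2
  -- Measurability of the set of integrable sections relies on σ-finiteness, hence the passage to
  -- the restriction of ν to S.
  have hIm : MeasurableSet {x | Integrable (fun y => g (x, y)) ν} := by
    have : {x | Integrable (fun y => g (x, y)) ν}
        = {x | Integrable (fun y => g (x, y)) (ν.restrict S)} := by
      ext x
      simp only [Set.mem_ofPred_eq]
      exact (integrableOn_iff_integrable_of_support_subset fun y hy => by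
        by_contra h; exact hy (hsupp x y h)).symm
    rw [this]
    exact measurableSet_integrable hg.stronglyMeasurable
  let φ : ℕ → SimpleFunc (M × N) 𝕜 := fun n =>
    SimpleFunc.approxOn g hg Set.univ 0 (Set.mem_univ 0) n
  -- The constant 2 comes from the bound ‖φ n z‖ ≤ ‖g z‖ + ‖g z‖ for simple approximations based at
  -- 0.
  refine stronglyMeasurable_sectionL1_of_tendsto (C := 2)
      (k := fun n z => φ n z * (Set.univ ∩ Set.univ ×ˢ T n).indicator (1 : M × N → 𝕜) z)
      hIm (fun n => (φ n).measurable.mul (measurable_one.indicator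
        (MeasurableSet.univ.inter (MeasurableSet.univ.prod (hT n)))))
      (fun n => (hsimple n _).2) ?_ ?_
  · intro n z
    have h1 : ‖φ n z‖ ≤ ‖g z‖ + ‖g z‖ := SimpleFunc.norm_approxOn_zero_le hg (Set.mem_univ 0) z n
    by_cases hz : z ∈ Set.univ ∩ Set.univ ×ˢ T n
    · simp only [Set.indicator_of_mem hz, Pi.one_apply, mul_one]; linarith
    · simp only [Set.indicator_of_notMem hz, mul_zero, norm_zero]; positivity
  · rintro ⟨x, y⟩
    have hφ : Tendsto (fun n => φ n (x, y)) atTop (𝓝 (g (x, y))) :=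
      SimpleFunc.tendsto_approxOn hg (Set.mem_univ 0) (by simp)
    by_cases hy : y ∈ S
    · refine hφ.congr' ?_
      obtain ⟨m, hm⟩ := Set.mem_iUnion.1
        ((iUnion_spanningSets (ν.restrict S)).symm ▸ Set.mem_univ y)
      filter_upwards [eventually_ge_atTop m] with n hn
      have : y ∈ T n := ⟨hy, monotone_spanningSets _ hn hm⟩
      simp [Set.indicator, this]
    · rw [hsupp x y hy]
      refine tendsto_const_nhds.congr fun n => ?_
      have : y ∉ T n := fun h => hy h.1
      simp [Set.indicator, this]

theorem exists_realizes {μ : Measure M} {S : Set N} (hS : MeasurableSet S)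
    (hσ : SigmaFinite (ν.restrict S)) {g : M × N → 𝕜} (hg : Measurable g)
    (hsupp : ∀ x, ∀ y ∉ S, g (x, y) = 0) (C : NNReal)
    (hC : ∀ᵐ x ∂μ, ∫⁻ y, ‖g (x, y)‖ₑ ∂ν ≤ C) :
    ∃ u : LInftyL1 𝕜 μ ν, Realizes g u ∧ ‖u‖ ≤ C := by
  have hsm := stronglyMeasurable_sectionL1 hS hσ hg hsupp
  have hint : ∀ᵐ x ∂μ, Integrable (fun y => g (x, y)) ν := by
    filter_upwards [hC] with x hx
    exact ⟨(hg.comp measurable_prodMk_left).aestronglyMeasurable, hx.trans_lt ENNReal.coe_lt_top⟩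
  have hbd : ∀ᵐ x ∂μ, ‖sectionL1 ν g x‖ ≤ C := by
    filter_upwards [hC, hint] with x hx hi
    rw [sectionL1_of_integrable hi, Integrable.norm_toL1_eq_lintegral_enorm]
    exact ENNReal.toReal_le_coe_of_le_coe hx
  have hmem : MemLp (sectionL1 ν g) ∞ μ := memLp_top_of_bound hsm.aestronglyMeasurable C hbd
  refine ⟨hmem.toLp _, ⟨hg, ?_⟩, ?_⟩
  · filter_upwards [hmem.coeFn_toLp, hint] with x hx hi
    rw [hx, sectionL1_of_integrable hi]
    exact hi.coeFn_toL1.symm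
  · rw [Lp.norm_toLp, eLpNorm_exponent_top]
    refine ENNReal.toReal_le_coe_of_le_coe ?_
    exact eLpNormEssSup_le_of_ae_nnnorm_bound hbd

end SectionL1

/-! ### Exhaustion by σ-finite sets. -/

theorem sigmaFinite_restrict_iUnion {α ι : Type*} [MeasurableSpace α] [Countable ι]
    {μ : Measure α} {S : ι → Set α} (hS : ∀ i, MeasurableSet (S i))
    (h : ∀ i, SigmaFinite (μ.restrict (S i))) : SigmaFinite (μ.restrict (⋃ i, S i)) := by
  refine Measure.sigmaFinite_of_countable (S := insert (⋃ i, S i)ᶜ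
    (Set.range fun p : ι × ℕ => S p.1 ∩ spanningSets (μ.restrict (S p.1)) p.2))
    ((Set.countable_range _).insert _) ?_ ?_
  · rintro s (rfl | ⟨⟨i, n⟩, rfl⟩)
    · rw [Measure.restrict_apply (MeasurableSet.iUnion hS).compl,
        Set.compl_inter_self, measure_empty]
      exact ENNReal.zero_lt_top
    · refine (Measure.restrict_apply_le _ _).trans_lt ?_
      have := measure_spanningSets_lt_top (μ.restrict (S i)) n
      rwa [Measure.restrict_apply (measurableSet_spanningSets _ n), Set.inter_comm] at this
  · refine Set.eq_univ_of_forall fun x => ?_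
    by_cases hx : x ∈ ⋃ i, S i
    · obtain ⟨i, hi⟩ := Set.mem_iUnion.1 hx
      obtain ⟨n, hn⟩ := Set.mem_iUnion.1
        ((iUnion_spanningSets (μ.restrict (S i))).symm ▸ Set.mem_univ x)
      exact ⟨_, Or.inr ⟨(i, n), rfl⟩, hi, hn⟩
    · exact ⟨_, Or.inl rfl, hx⟩

/-- If the measures of the subsets of finite measure of `T` are bounded, then `T` has a subset
of finite measure whose complement in `T` has no subset of positive finite measure. -/
theorem exists_finite_measure_exhausting {α : Type*} [MeasurableSpace α] (μ : Measure α)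
    (T : Set α) (C : ℝ≥0∞) (hC : C ≠ ∞)
    (h : ∀ E ⊆ T, MeasurableSet E → μ E < ∞ → μ E ≤ C) :
    ∃ E ⊆ T, MeasurableSet E ∧ μ E < ∞ ∧
      ∀ G ⊆ T \ E, MeasurableSet G → μ G < ∞ → μ G = 0 := by
  let V : Set ℝ≥0∞ := {r | ∃ E ⊆ T, MeasurableSet E ∧ μ E < ∞ ∧ μ E = r}
  obtain ⟨r, hrm, hrlim, hr⟩ := exists_seq_tendsto_sSup (S := V)
    ⟨0, ∅, Set.empty_subset _, .empty, by simp, by simp⟩ (OrderTop.bddAbove _)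
  choose E hET hE hEfin hEr using hr
  have hsup : ∀ G ⊆ T, MeasurableSet G → μ G < ∞ → μ G ≤ sSup V := fun G h1 h2 h3 =>
    le_sSup ⟨G, h1, h2, h3, rfl⟩
  have hle : μ (⋃ n, E n) ≤ sSup V := by
    rw [measure_iUnion_eq_iSup_accumulate]
    refine iSup_le fun n => hsup _ (Set.iUnion₂_subset fun i _ => hET i)
      (.biUnion (Set.to_countable _) fun i _ => hE i) ?_
    exact measure_biUnion_lt_top (Set.finite_Iic n) fun i _ => hEfin i
  have hsupC : sSup V ≤ C := sSup_le (by rintro _ ⟨G, h1, h2, h3, rfl⟩; exact h G h1 h2 h3)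
  -- The union of a maximising sequence attains the supremum, so a further disjoint set of finite
  -- measure must be null.
  have hge : sSup V ≤ μ (⋃ n, E n) :=
    le_of_tendsto' hrlim fun n => hEr n ▸ measure_mono (Set.subset_iUnion E n)
  have hfin : μ (⋃ n, E n) < ∞ := (hle.trans hsupC).trans_lt hC.lt_top
  refine ⟨⋃ n, E n, Set.iUnion_subset hET, .iUnion hE, hfin, fun G hG hGm hGfin => ?_⟩
  have hdisj : Disjoint (⋃ n, E n) G := Set.disjoint_left.2 fun x h1 h2 => (hG h2).2 h1
  have h1 := hsup ((⋃ n, E n) ∪ G) (Set.union_subset (Set.iUnion_subset hET)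
    (hG.trans Set.sdiff_subset)) ((MeasurableSet.iUnion hE).union hGm)
    (measure_union_lt_top hfin hGfin)
  rw [measure_union hdisj hGm] at h1
  have h2 : μ (⋃ n, E n) + μ G ≤ μ (⋃ n, E n) + 0 := by rw [add_zero]; exact h1.trans hge
  exact le_antisymm ((ENNReal.add_le_add_iff_left hfin.ne).1 h2) bot_le

/-- Let E be a set of finite measure outside A on which the fibre integral over `F n` exceeds r. If
μ(E) > κ ν(F n), the rectangle bound would give r μ(E) ≤ s μ(E), contradicting s < r. Such sets
therefore have bounded measure and are exhausted by one set of finite measure; P collects these over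
n. What remains is null only inside each G of finite measure. -/
theorem exists_sigmaFinite_forall_ae_le {M N : Type*} [MeasurableSpace M] [MeasurableSpace N]
    (μ : Measure M) (ν : Measure N) {A : Set M} {B : Set N} (hA : MeasurableSet A)
    (hB : MeasurableSet B) (hσ : SigmaFinite (ν.restrict B)) (h : M × N → ℝ≥0∞)
    (hh : Measurable h) (s r κ : ℝ≥0∞) (hsr : s < r) (hκ : κ ≠ ∞)
    (hrect : ∀ E F, MeasurableSet E → MeasurableSet F → E ⊆ Aᶜ → μ E < ∞ → ν F < ∞ →
      ∫⁻ x in E, ∫⁻ y in F, h (x, y) ∂ν ∂μ ≤ s * max (μ E) (κ * ν F)) :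
    ∃ P : Set M, MeasurableSet P ∧ SigmaFinite (μ.restrict P) ∧
      ∀ G, MeasurableSet G → μ G < ∞ →
        ∀ᵐ x ∂μ.restrict G, x ∉ A ∪ P → ∫⁻ y in B, h (x, y) ∂ν ≤ r := by
  let F : ℕ → Set N := fun n => B ∩ spanningSets (ν.restrict B) n
  have hF : ∀ n, MeasurableSet (F n) := fun n => hB.inter (measurableSet_spanningSets _ n)
  have hFfin : ∀ n, ν (F n) < ∞ := fun n => by
    have := measure_spanningSets_lt_top (ν.restrict B) n
    rwa [Measure.restrict_apply (measurableSet_spanningSets _ n), Set.inter_comm] at this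
  have hFU : ⋃ n, F n = B := by
    rw [← Set.inter_iUnion, iUnion_spanningSets, Set.inter_univ]
  have hFmono : Monotone F := fun m n hmn =>
    Set.inter_subset_inter_right _ (monotone_spanningSets _ hmn)
  have hw : ∀ n, Measurable fun x => ∫⁻ y in F n, h (x, y) ∂ν := fun n => by
    have : IsFiniteMeasure (ν.restrict (F n)) := ⟨by simpa using hFfin n⟩
    exact hh.lintegral_prod_right'
  let T : ℕ → Set M := fun n => {x | r < ∫⁻ y in F n, h (x, y) ∂ν} \ A
  have hT : ∀ n, MeasurableSet (T n) := fun n => (measurableSet_lt measurable_const (hw n)).diff hA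
  have hbdd : ∀ n, ∀ E ⊆ T n, MeasurableSet E → μ E < ∞ → μ E ≤ κ * ν (F n) := by
    intro n E hE hEm hEfin
    by_contra! hlt
    have h1 := hrect E (F n) hEm (hF n) (fun x hx => (hE hx).2) hEfin (hFfin n)
    rw [max_eq_left hlt.le] at h1
    have h2 : r * μ E ≤ ∫⁻ x in E, ∫⁻ y in F n, h (x, y) ∂ν ∂μ := by
      rw [← setLIntegral_const]
      exact setLIntegral_mono' hEm fun x hx => (hE hx).1.le
    exact (h2.trans h1).not_gt ((ENNReal.mul_lt_mul_iff_left (bot_le.trans_lt hlt).ne' hEfin.ne).2 hsr)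
  choose P hPT hP hPfin hPex using fun n => exists_finite_measure_exhausting μ (T n) _
    (ENNReal.mul_ne_top hκ (hFfin n).ne) (hbdd n)
  refine ⟨⋃ n, P n, .iUnion hP, sigmaFinite_restrict_iUnion hP fun n => ?_, fun G hG hGfin => ?_⟩
  · have : IsFiniteMeasure (μ.restrict (P n)) := ⟨by simpa using hPfin n⟩
    infer_instance
  · rw [ae_restrict_iff' hG]
    have hnull : ∀ n, μ (G ∩ (T n \ P n)) = 0 := fun n =>
      hPex n _ Set.inter_subset_right (hG.inter ((hT n).diff (hP n)))
        ((measure_mono Set.inter_subset_left).trans_lt hGfin)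
    have hall : ∀ᵐ x ∂μ, ∀ n, x ∉ G ∩ (T n \ P n) :=
      ae_all_iff.2 fun n => measure_eq_zero_iff_ae_notMem.1 (hnull n)
    filter_upwards [hall] with x hx hxG hxA
    rw [← hFU, setLIntegral_iUnion_of_directed _ hFmono.directed_le]
    refine iSup_le fun n => ?_
    by_contra! hlt
    exact hx n ⟨hxG, ⟨hlt, fun h => hxA (Or.inl h)⟩,
      fun h => hxA (Or.inr (Set.mem_iUnion.2 ⟨n, h⟩))⟩

/-! ### Carriers of the two summands, and the rectangle estimates. -/

section Decomposition

variable {𝕜 : Type*} [RCLike 𝕜] {M N : Type*} [MeasurableSpace M] [MeasurableSpace N]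
  {μ : Measure M} {ν : Measure N}

/-- The values of an element of `L^∞(dμ; L^1(dν))` are carried by a common σ-finite set. -/
theorem exists_sigmaFinite_support (u : LInftyL1 𝕜 μ ν) :
    ∃ S : Set N, MeasurableSet S ∧ SigmaFinite (ν.restrict S) ∧
      ∀ᵐ x ∂μ, ∀ᵐ y ∂ν, y ∉ S → (u x : N → 𝕜) y = 0 := by
  have hu := Lp.aestronglyMeasurable u
  obtain ⟨c, hc, hcl⟩ := hu.stronglyMeasurable_mk.isSeparable_range
  have hex : ∀ v : Lp 𝕜 1 ν, ∃ S : Set N, MeasurableSet S ∧ v =ᵐ[ν.restrict Sᶜ] 0 ∧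
      SigmaFinite (ν.restrict S) := fun v =>
    ((Lp.memLp v).aefinStronglyMeasurable one_ne_zero ENNReal.one_ne_top).exists_set_sigmaFinite
  choose S hS h0 hσ using hex
  have := hc.to_subtype
  have hm : MeasurableSet (⋃ v : c, S v) := .iUnion fun v => hS v
  refine ⟨⋃ v : c, S v, hm, sigmaFinite_restrict_iUnion (fun v => hS v) fun v => hσ v, ?_⟩
  filter_upwards [hu.ae_eq_mk] with x hx
  have hmem : u x ∈ closure c := hx ▸ hcl (Set.mem_range_self x)
  have hzero : ∫⁻ y in (⋃ v : c, S v)ᶜ, ‖(u x : N → 𝕜) y‖ₑ ∂ν = 0 := by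
    refine le_antisymm (ENNReal.le_of_forall_pos_le_add fun ε hε _ => ?_) bot_le
    -- A nearby v from the countable dense set vanishes off the common carrier, so the mass of `u x`
    -- there is at most its distance to v.
    obtain ⟨v, hv, hlt⟩ := EMetric.mem_closure_iff.1 hmem ε (by exact_mod_cast hε)
    rw [L1.edist_def] at hlt
    rw [zero_add]
    refine le_trans ?_ hlt.le
    refine le_trans ?_ (setLIntegral_le_lintegral (⋃ v : c, S v)ᶜ _)
    refine lintegral_mono_ae ?_
    have hsub : (⋃ v : c, S v)ᶜ ⊆ (S v)ᶜ :=
      Set.compl_subset_compl.2 (Set.subset_iUnion (fun v : c => S v) ⟨v, hv⟩)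
    filter_upwards [ae_restrict_of_ae_restrict_of_subset hsub (h0 v)] with y hy
    rw [hy, Pi.zero_apply, edist_zero_right]
  rw [lintegral_eq_zero_iff' (Lp.aestronglyMeasurable (u x)).enorm.restrict] at hzero
  have := (ae_restrict_iff' hm.compl).1 hzero
  filter_upwards [this] with y hy hyS
  simpa using hy hyS

/-- Truncation of a realization to a carrier of the values of the realized element. -/
theorem Realizes.ae_prod_eq_indicator {b : M × N → 𝕜} {u : LInftyL1 𝕜 μ ν}
    (hb : Realizes b u) {S : Set N} (hS : MeasurableSet S)
    (hsupp : ∀ᵐ x ∂μ, ∀ᵐ y ∂ν, y ∉ S → (u x : N → 𝕜) y = 0) {E : Set M} {F : Set N}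
    (hF : ν F < ∞) :
    ∀ᵐ z ∂(μ.restrict E).prod (ν.restrict F), b z = (Set.univ ×ˢ S).indicator b z := by
  have : IsFiniteMeasure (ν.restrict F) := ⟨by simpa using hF⟩
  rw [Measure.ae_prod_iff_ae_ae (measurableSet_eq_fun hb.1
    (hb.1.indicator (MeasurableSet.univ.prod hS)))]
  filter_upwards [ae_restrict_of_ae hb.2, ae_restrict_of_ae hsupp] with x h1 h2
  filter_upwards [ae_restrict_of_ae h1, ae_restrict_of_ae h2] with y h3 h4
  by_cases hy : y ∈ S
  · simp [Set.indicator, hy]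
  · simp [Set.indicator, hy, h3, h4 hy]

theorem MemSum.exists_sigmaFinite_carriers {f : M × N → 𝕜} (hf : MemSum μ ν f) :
    ∃ (b c : M × N → 𝕜) (A : Set M) (B : Set N), Measurable b ∧ Measurable c ∧
      MeasurableSet A ∧ MeasurableSet B ∧ SigmaFinite (μ.restrict A) ∧
      SigmaFinite (ν.restrict B) ∧ (∀ x, ∀ y ∉ B, b (x, y) = 0) ∧
      (∀ x ∉ A, ∀ y, c (x, y) = 0) ∧ LocallyAEEq μ ν f (fun z => b z + c z) := by
  obtain ⟨u, v, b, c, hb, hc, hfbc⟩ := hf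
  obtain ⟨B, hB, hBσ, hBs⟩ := exists_sigmaFinite_support u
  obtain ⟨A, hA, hAσ, hAs⟩ := exists_sigmaFinite_support v
  have hcm : Measurable c := hc.1.comp measurable_swap
  refine ⟨(Set.univ ×ˢ B).indicator b, (A ×ˢ Set.univ).indicator c, A, B,
    hb.1.indicator (MeasurableSet.univ.prod hB), hcm.indicator (hA.prod .univ), hA, hB, hAσ, hBσ,
    fun x y hy => by simp [hy], fun x hx y => by simp [hx], fun E F hE hF hE' hF' => (hfbc E F hE hF hE' hF').trans ?_⟩
  have : IsFiniteMeasure (ν.restrict F) := ⟨by simpa using hF'⟩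
  have : IsFiniteMeasure (μ.restrict E) := ⟨by simpa using hE'⟩
  have h1 := hb.ae_prod_eq_indicator hB hBs (E := E) hF'
  have h2 := hc.ae_prod_eq_indicator hA hAs (E := F) hE'
  have h3 := (Measure.measurePreserving_swap (μ := μ.restrict E)
    (ν := ν.restrict F)).quasiMeasurePreserving.ae h2
  filter_upwards [h1, h3] with z h4 h5
  have h6 : c z = (A ×ˢ Set.univ).indicator c z := by
    obtain ⟨x, y⟩ := z
    simpa [Set.indicator] using h5
  rw [← h4, ← h6]

theorem Realizes.lintegral_rectangle_le {b : M × N → 𝕜} {u : LInftyL1 𝕜 μ ν}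
    (hb : Realizes b u) {E : Set M} {F : Set N} (hF : ν F < ∞) :
    ∫⁻ z, ‖b z‖ₑ ∂(μ.restrict E).prod (ν.restrict F) ≤ ‖u‖ₑ * μ E := by
  have : IsFiniteMeasure (ν.restrict F) := ⟨by simpa using hF⟩
  rw [lintegral_prod _ hb.1.enorm.aemeasurable, ← setLIntegral_const]
  refine lintegral_mono_ae ?_
  have hess : ∀ᵐ x ∂μ, ‖u x‖ₑ ≤ ‖u‖ₑ := by
    rw [Lp.enorm_def, eLpNorm_exponent_top]
    exact ae_le_eLpNormEssSup
  filter_upwards [ae_restrict_of_ae hb.2, ae_restrict_of_ae hess] with x h1 h2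
  refine (setLIntegral_le_lintegral F _).trans (le_trans (le_of_eq ?_) h2)
  rw [Lp.enorm_def, eLpNorm_one_eq_lintegral_enorm]
  exact lintegral_congr_ae (h1.mono fun y hy => by simp only [hy])

theorem rectangleSup_le_kFunctional (f : M × N → 𝕜) {t : ℝ} (ht : 0 < t) :
    rectangleSup μ ν t f ≤ kFunctional μ ν t f := by
  refine le_iInf fun u => le_iInf fun v => le_iInf fun huv => ?_
  obtain ⟨b, c, hb, hc, hfbc⟩ := huv
  refine iSup_le fun E => iSup_le fun F => iSup_le fun hE => iSup_le fun hF => ?_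
  have : IsFiniteMeasure (ν.restrict F) := ⟨by simpa using hF.2.2⟩
  have : IsFiniteMeasure (μ.restrict E) := ⟨by simpa using hE.2.2⟩
  have h2 : ∫⁻ z, ‖c z‖ₑ ∂(μ.restrict E).prod (ν.restrict F) ≤ ‖v‖ₑ * ν F := by
    refine le_trans (le_of_eq ?_) (hc.lintegral_rectangle_le (E := F) hE.2.2)
    rw [← Measure.prod_swap, lintegral_map (by have := hc.1.comp measurable_swap; exact this.enorm)
      measurable_swap]
    rfl
  set m := max (μ E) (ENNReal.ofReal t⁻¹ * ν F) with hm
  have hF' : ν F ≤ ENNReal.ofReal t * m := by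
    calc ν F = ENNReal.ofReal t * (ENNReal.ofReal t⁻¹ * ν F) := by
          rw [← mul_assoc, ← ENNReal.ofReal_mul ht.le, mul_inv_cancel₀ ht.ne', ENNReal.ofReal_one,
            one_mul]
      _ ≤ _ := by gcongr; exact le_max_right _ _
  have hint : ∫⁻ z, ‖f z‖ₑ ∂(μ.restrict E).prod (ν.restrict F) ≤ m * ENNReal.ofReal (‖u‖ + t * ‖v‖) :=
    calc ∫⁻ z, ‖f z‖ₑ ∂(μ.restrict E).prod (ν.restrict F)
        ≤ ∫⁻ z, (‖b z‖ₑ + ‖c z‖ₑ) ∂(μ.restrict E).prod (ν.restrict F) := by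
          refine lintegral_mono_ae ?_
          filter_upwards [hfbc E F hE.1 hF.1 hE.2.2 hF.2.2] with z hz
          rw [hz]
          exact enorm_add_le _ _
      _ ≤ ‖u‖ₑ * μ E + ‖v‖ₑ * ν F := by
          rw [lintegral_add_left hb.1.enorm]
          exact add_le_add (hb.lintegral_rectangle_le hF.2.2) h2
      _ ≤ ‖u‖ₑ * m + ‖v‖ₑ * (ENNReal.ofReal t * m) := by
          gcongr
          exact le_max_left _ _
      _ = m * ENNReal.ofReal (‖u‖ + t * ‖v‖) := by
          rw [ENNReal.ofReal_add (norm_nonneg _) (by positivity), ENNReal.ofReal_mul ht.le,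
            ofReal_norm, ofReal_norm]
          ring
  calc m⁻¹ * ∫⁻ z, ‖f z‖ₑ ∂(μ.restrict E).prod (ν.restrict F)
      ≤ m⁻¹ * (m * ENNReal.ofReal (‖u‖ + t * ‖v‖)) := by gcongr
    _ = m⁻¹ * m * ENNReal.ofReal (‖u‖ + t * ‖v‖) := by rw [mul_assoc]
    _ ≤ 1 * ENNReal.ofReal (‖u‖ + t * ‖v‖) := by gcongr; exact ENNReal.inv_mul_le_one _
    _ = _ := one_mul _

/-- Null sides, excluded from the supremum, give a zero integral; this frees later arguments from
positivity conditions. -/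
theorem lintegral_rectangle_le_rectangleSup_mul (f : M × N → 𝕜) (t : ℝ) {E : Set M} {F : Set N}
    (hE : MeasurableSet E) (hF : MeasurableSet F) (hE' : μ E < ∞) (hF' : ν F < ∞) :
    ∫⁻ z, ‖f z‖ₑ ∂(μ.restrict E).prod (ν.restrict F)
      ≤ rectangleSup μ ν t f * max (μ E) (ENNReal.ofReal t⁻¹ * ν F) := by
  have : IsFiniteMeasure (ν.restrict F) := ⟨by simpa using hF'⟩
  rcases eq_or_ne (μ E) 0 with h0 | h0
  · simp [Measure.restrict_eq_zero.2 h0]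
  rcases eq_or_ne (ν F) 0 with h1 | h1
  · simp [Measure.restrict_eq_zero.2 h1]
  have hle : (max (μ E) (ENNReal.ofReal t⁻¹ * ν F))⁻¹ *
      ∫⁻ z, ‖f z‖ₑ ∂((μ.restrict E).prod (ν.restrict F)) ≤ rectangleSup μ ν t f :=
    le_iSup_of_le E <| le_iSup_of_le F <| le_iSup_of_le ⟨hE, pos_iff_ne_zero.2 h0, hE'⟩ <|
      le_iSup_of_le ⟨hF, pos_iff_ne_zero.2 h1, hF'⟩ le_rfl
  have hm0 : max (μ E) (ENNReal.ofReal t⁻¹ * ν F) ≠ 0 :=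
    ((pos_iff_ne_zero.2 h0).trans_le (le_max_left _ _)).ne'
  have hmtop : max (μ E) (ENNReal.ofReal t⁻¹ * ν F) ≠ ∞ :=
    (max_lt hE' (ENNReal.mul_lt_top ENNReal.ofReal_lt_top hF')).ne
  rwa [mul_comm, ← div_eq_mul_inv, ENNReal.div_le_iff hm0 hmtop] at hle

end Decomposition

/-! ### Construction of a decomposition with both norms controlled. -/

section Main

variable {𝕜 : Type*} [RCLike 𝕜] {M N : Type*} [MeasurableSpace M] [MeasurableSpace N]
  {μ : Measure M} {ν : Measure N}

/-- With A and B enlarged, f is locally b on Aᶜ × B, c on A × Bᶜ and 0 on Aᶜ × Bᶜ, so each part can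
go entirely to its own space. Only on A × B, a product of σ-finite sets, is the Hall splitting
needed. -/
theorem MemSum.exists_isSumOf_norm_le {f : M × N → 𝕜} (hf : MemSum μ ν f) {t : ℝ} (ht : 0 < t)
    (r : NNReal) (hr : rectangleSup μ ν t f < r) :
    ∃ (u : LInftyL1 𝕜 μ ν) (v : LInftyL1 𝕜 ν μ), IsSumOf f u v ∧ ‖u‖ ≤ r ∧ ‖v‖ ≤ r * t⁻¹ := by
  classical
  obtain ⟨b, c, A₀, B₀, hb, hc, hA₀, hB₀, hA₀σ, hB₀σ, hbB, hcA, hfbc⟩ :=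
    hf.exists_sigmaFinite_carriers
  have hbc : Measurable fun z => b z + c z := hb.add hc
  have hrect := fun (E : Set M) (F : Set N) => lintegral_rectangle_le_rectangleSup_mul
    (μ := μ) (ν := ν) f t (E := E) (F := F)
  set s := rectangleSup μ ν t f
  have hr0 : (0 : ℝ≥0∞) < r := bot_le.trans_lt hr
  let τ : NNReal := t.toNNReal
  have hτ : τ ≠ 0 := (Real.toNNReal_pos.2 ht).ne'
  have hτinv : ENNReal.ofReal t⁻¹ = ((τ⁻¹ : NNReal) : ℝ≥0∞) := by
    rw [ENNReal.ofReal, Real.toNNReal_inv]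
  rw [hτinv] at hrect
  have hrect' : ∀ E F, MeasurableSet E → MeasurableSet F → μ E < ∞ → ν F < ∞ →
      ∫⁻ z, ‖b z + c z‖ₑ ∂(μ.restrict E).prod (ν.restrict F)
        ≤ s * max (μ E) ((τ⁻¹ : NNReal) * ν F) := by
    intro E F hE hF hE' hF'
    refine le_trans (le_of_eq (lintegral_congr_ae ?_)) (hrect E F hE hF hE' hF')
    filter_upwards [hfbc E F hE hF hE' hF'] with z hz
    rw [hz]
  obtain ⟨P, hP, hPσ, hPae⟩ := exists_sigmaFinite_forall_ae_le μ ν hA₀ hB₀ hB₀σ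
    (fun z => ‖b z‖ₑ) hb.enorm s r (τ⁻¹ : NNReal) hr ENNReal.coe_ne_top (by
      intro E F hE hF hEA hE' hF'
      have : IsFiniteMeasure (ν.restrict F) := ⟨by simpa using hF'⟩
      refine le_trans (le_of_eq ?_) (hrect' E F hE hF hE' hF')
      rw [lintegral_prod _ hbc.enorm.aemeasurable]
      refine setLIntegral_congr_fun hE fun x hx => ?_
      simp only [hcA x (hEA hx), add_zero])
  -- The same argument with the factors exchanged: s max(μ(E), τ⁻¹ ν(F)) = s τ⁻¹ max(ν(F), τ μ(E)),
  -- which explains the rescaled constants.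
  obtain ⟨Q, hQ, hQσ, hQae⟩ := exists_sigmaFinite_forall_ae_le ν μ hB₀ hA₀ hA₀σ
    (fun z => ‖c z.swap‖ₑ) (hc.comp measurable_swap).enorm (s * (τ⁻¹ : NNReal))
    (r * (τ⁻¹ : NNReal)) τ
    ((ENNReal.mul_lt_mul_iff_left (by simpa using hτ) ENNReal.coe_ne_top).2 hr)
    ENNReal.coe_ne_top (by
      intro F E hF hE hFB hF' hE'
      have : IsFiniteMeasure (ν.restrict F) := ⟨by simpa using hF'⟩
      have : IsFiniteMeasure (μ.restrict E) := ⟨by simpa using hE'⟩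
      refine le_trans (le_of_eq ?_) ((hrect' E F hE hF hE' hF').trans (le_of_eq ?_))
      · rw [lintegral_prod_symm _ hbc.enorm.aemeasurable]
        refine setLIntegral_congr_fun hF fun y hy => ?_
        simp only [fun x => hbB x y (hFB hy), zero_add, Prod.swap_prod_mk]
      · rw [mul_assoc]
        congr 1
        rw [mul_max, ← mul_assoc _ (τ : ℝ≥0∞), ← ENNReal.coe_mul, inv_mul_cancel₀ hτ,
          ENNReal.coe_one, one_mul, max_comm])
  set A := A₀ ∪ P with hAdef
  set B := B₀ ∪ Q with hBdef
  have hA : MeasurableSet A := hA₀.union hP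
  have hB : MeasurableSet B := hB₀.union hQ
  have hAσ : SigmaFinite (μ.restrict A) := inferInstance
  have hBσ : SigmaFinite (ν.restrict B) := inferInstance
  obtain ⟨φ, ψ, hφ, hψ, hφψ, hφr, hψr⟩ := exists_density_split (μ.restrict A) (ν.restrict B)
    (fun z => ‖b z + c z‖ₑ) hbc.enorm r (r * τ⁻¹) (by
      intro E F hE hF
      have hrτ : ((r * τ⁻¹ : NNReal) : ℝ≥0∞) ≠ 0 := by
        simpa [hτ] using hr0.ne'
      rw [Measure.restrict_apply hE, Measure.restrict_apply hF]
      -- The supremum sees only sides of finite measure; an infinite side makes the right-hand side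
      -- infinite because its coefficient is nonzero.
      rcases eq_or_ne (μ (E ∩ A)) ∞ with h1 | h1
      · rw [h1, ENNReal.mul_top hr0.ne', top_add]; exact le_top
      rcases eq_or_ne (ν (F ∩ B)) ∞ with h2 | h2
      · rw [h2, ENNReal.mul_top hrτ, add_top]; exact le_top
      rw [← Measure.prod_restrict, Measure.restrict_restrict hE, Measure.restrict_restrict hF]
      refine (hrect' _ _ (hE.inter hA) (hF.inter hB) h1.lt_top h2.lt_top).trans ?_
      rw [ENNReal.coe_mul, mul_assoc]
      calc s * max (μ (E ∩ A)) ((τ⁻¹ : NNReal) * ν (F ∩ B))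
          ≤ r * (μ (E ∩ A) + (τ⁻¹ : NNReal) * ν (F ∩ B)) := by
            gcongr
            exact max_le le_self_add le_add_self
        _ = _ := mul_add _ _ _)
  let wb : M → ℝ≥0∞ := fun x => ∫⁻ y in B₀, ‖b (x, y)‖ₑ ∂ν
  let wc : N → ℝ≥0∞ := fun y => ∫⁻ x in A₀, ‖c (x, y)‖ₑ ∂μ
  have hwb : Measurable wb := hb.enorm.lintegral_prod_right'
  have hwc : Measurable wc := Measurable.lintegral_prod_left' (f := fun z => ‖c z‖ₑ) hc.enorm
  -- The fibre bound for b off A is known only locally almost everywhere, while membership in the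
  -- Bochner space needs it globally. Discarding the fibres that exceed the threshold secures the
  -- bound and changes nothing almost everywhere on finite rectangles.
  let g : M × N → 𝕜 := fun z =>
    if z.1 ∈ A then (if z.2 ∈ B then ((φ z).toReal : 𝕜) * (b z + c z) else 0)
    else if wb z.1 ≤ r then b z else 0
  let k : M × N → 𝕜 := fun z =>
    if z.2 ∈ B then (if z.1 ∈ A then ((ψ z).toReal : 𝕜) * (b z + c z) else 0)
    else if wc z.2 ≤ r * (τ⁻¹ : NNReal) then c z else 0
  have hmA : MeasurableSet {z : M × N | z.1 ∈ A} := measurable_fst hA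
  have hmB : MeasurableSet {z : M × N | z.2 ∈ B} := measurable_snd hB
  have hg : Measurable g := by
    refine Measurable.ite hmA (Measurable.ite hmB ?_ measurable_const)
      (Measurable.ite (measurableSet_le (hwb.comp measurable_fst) measurable_const) hb
        measurable_const)
    exact (RCLike.measurable_ofReal.comp hφ.ennreal_toReal).mul hbc
  have hk : Measurable k := by
    refine Measurable.ite hmB (Measurable.ite hmA ?_ measurable_const)
      (Measurable.ite (measurableSet_le (hwc.comp measurable_snd) measurable_const) hc
        measurable_const)
    exact (RCLike.measurable_ofReal.comp hψ.ennreal_toReal).mul hbc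
  have henorm : ∀ (θ : ℝ≥0∞) (a : 𝕜), ‖(θ.toReal : 𝕜) * a‖ₑ ≤ ‖a‖ₑ * θ := by
    intro θ a
    rw [enorm_mul, mul_comm]
    gcongr
    rw [← ofReal_norm, RCLike.norm_ofReal, abs_of_nonneg ENNReal.toReal_nonneg]
    exact ENNReal.ofReal_toReal_le
  obtain ⟨u, hu, hur⟩ := exists_realizes (μ := μ) hB hBσ hg (by
    intro x y hy
    have : b (x, y) = 0 := hbB x y fun h => hy (Or.inl h)
    simp [g, hy, this]) r (by
    filter_upwards [(ae_restrict_iff' hA).1 hφr] with x hx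
    by_cases hxA : x ∈ A
    · refine le_trans ?_ (hx hxA)
      rw [← lintegral_indicator hB]
      refine lintegral_mono fun y => ?_
      by_cases hy : y ∈ B
      · simpa [g, hxA, hy] using henorm (φ (x, y)) (b (x, y) + c (x, y))
      · simp [g, hxA, hy]
    · by_cases hw : wb x ≤ r
      · refine le_trans (le_of_eq ?_) hw
        simp only [g, hxA, hw, if_false, if_true, wb]
        refine (setLIntegral_eq_of_support_subset fun y hy => ?_).symm
        by_contra h
        exact hy (by simp [hbB x y h])
      · simp [g, hxA, hw])
  obtain ⟨v, hv, hvr⟩ := exists_realizes (μ := ν) hA hAσ (g := fun z : N × M => k (z.2, z.1))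
    (hk.comp measurable_swap) (by
    intro y x hx
    have : c (x, y) = 0 := hcA x (fun h => hx (Or.inl h)) y
    simp [k, hx, this]) (r * τ⁻¹) (by
    filter_upwards [(ae_restrict_iff' hB).1 hψr] with y hy
    by_cases hyB : y ∈ B
    · refine le_trans ?_ (hy hyB)
      rw [← lintegral_indicator hA]
      refine lintegral_mono fun x => ?_
      by_cases hx : x ∈ A
      · simpa [k, hyB, hx] using henorm (ψ (x, y)) (b (x, y) + c (x, y))
      · simp [k, hyB, hx]
    · by_cases hw : wc y ≤ r * (τ⁻¹ : NNReal)
      · refine le_trans (le_of_eq ?_) (hw.trans_eq (ENNReal.coe_mul _ _).symm)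
        simp only [k, hyB, hw, if_false, if_true, wc]
        refine (setLIntegral_eq_of_support_subset fun x hx => ?_).symm
        by_contra h
        exact hx (by simp [hcA x h])
      · simp [k, hyB, hw])
  refine ⟨u, v, ⟨g, k, hu, hv, fun E F hE hF hE' hF' => (hfbc E F hE hF hE' hF').trans ?_⟩, hur, ?_⟩
  · have : IsFiniteMeasure (ν.restrict F) := ⟨by simpa using hF'⟩
    have : IsFiniteMeasure (μ.restrict E) := ⟨by simpa using hE'⟩
    have h1 : ∀ᵐ z ∂(μ.restrict E).prod (ν.restrict F), z ∈ A ×ˢ B →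
        ‖b z + c z‖ₑ ≠ 0 → φ z + ψ z = 1 := by
      rw [← ae_restrict_iff' (hA.prod hB), ← Measure.prod_restrict, Measure.restrict_restrict hA,
        Measure.restrict_restrict hB]
      exact (Measure.AbsolutelyContinuous.prod
        (Measure.absolutelyContinuous_of_le (Measure.restrict_mono Set.inter_subset_left le_rfl))
        (Measure.absolutelyContinuous_of_le (Measure.restrict_mono Set.inter_subset_left
          le_rfl))).ae_le hφψ
    have h2 := (Measure.quasiMeasurePreserving_fst (μ := μ.restrict E)
      (ν := ν.restrict F)).ae (hPae E hE hE')
    have h3 := (Measure.quasiMeasurePreserving_snd (μ := μ.restrict E)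
      (ν := ν.restrict F)).ae (hQae F hF hF')
    filter_upwards [h1, h2, h3] with z hz1 hz2 hz3
    obtain ⟨x, y⟩ := z
    by_cases hx : x ∈ A <;> by_cases hy : y ∈ B
    · simp only [g, k, hx, hy, if_true]
      by_cases h0 : b (x, y) + c (x, y) = 0
      · simp [h0]
      · have hsum := hz1 ⟨hx, hy⟩ (by simpa using h0)
        -- Finiteness matters because `toReal` sends ∞ to 0; it follows from the sum being 1.
        have hφt : φ (x, y) ≠ ∞ := fun h => by simp [h] at hsum
        have hψt : ψ (x, y) ≠ ∞ := fun h => by simp [h] at hsum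
        rw [← add_mul, ← RCLike.ofReal_add, ← ENNReal.toReal_add hφt hψt, hsum]
        simp
    · have hb0 : b (x, y) = 0 := hbB x y fun h => hy (Or.inl h)
      have hw : wc y ≤ r * (τ⁻¹ : NNReal) := hz3 hy
      simp [g, k, hx, hy, hb0, hw]
    · have hc0 : c (x, y) = 0 := hcA x (fun h => hx (Or.inl h)) y
      have hw : wb x ≤ r := hz2 hx
      simp [g, k, hx, hy, hc0, hw]
    · have hw : wc y ≤ r * (τ⁻¹ : NNReal) := hz3 hy
      have hw' : wb x ≤ r := hz2 hx
      simp [g, k, hx, hy, hw, hw']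
  · refine hvr.trans (le_of_eq ?_)
    rw [NNReal.coe_mul, NNReal.coe_inv, Real.coe_toNNReal t ht.le]

end Main

theorem theorem0p1 {𝕜 : Type*} [RCLike 𝕜] {M N : Type*} [MeasurableSpace M] [MeasurableSpace N]
    (μ : Measure M) (ν : Measure N) (f : M × N → 𝕜) (hf : MemSum μ ν f) (t : ℝ) (ht : 0 < t) :
    kFunctional μ ν t f / 2 ≤ rectangleSup μ ν t f ∧
      rectangleSup μ ν t f ≤ kFunctional μ ν t f := by
  refine ⟨?_, rectangleSup_le_kFunctional f ht⟩
  by_contra! hlt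
  -- The construction needs r strictly above the supremum, so r is taken strictly between it and
  -- half of K.
  obtain ⟨r, hr1, hr2⟩ := ENNReal.lt_iff_exists_nnreal_btwn.1 hlt
  obtain ⟨u, v, huv, hu, hv⟩ := hf.exists_isSumOf_norm_le ht r hr1
  refine hr2.not_ge (ENNReal.div_le_of_le_mul ?_)
  refine (iInf_le_of_le u <| iInf_le_of_le v <| iInf_le _ huv).trans ?_
  have hle : ‖u‖ + t * ‖v‖ ≤ (r * 2 : NNReal) := by
    have h1 : t * ‖v‖ ≤ t * (r * t⁻¹) := mul_le_mul_of_nonneg_left hv ht.le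
    have h2 : t * (r * t⁻¹) = r := by field_simp
    push_cast
    linarith
  refine (ENNReal.ofReal_le_ofReal hle).trans ?_
  simp
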